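/- Let $d\ge 1$, $c,I,J\ge 0$ be integers and $m=(I+1)d+(J+1)c$. Consider the linear model $y_{t+1}=Ax_{t+1}+e_{t+1}$ with unknown parameters $\theta=(A,V)$, where $A\in\mathbb{R}^{d\times m}$, $V\in\mathbb{R}^{d\times d}$ is symmetric positive definite, and $$x_{t+1}=x(u)=[r_{t-I};\dots;r_t;u_{t-J+1};\dots;u_t;u]\in\mathbb{R}^m ,$$ with given past activities $r_{t-I},\dots,r_t\in\mathbb{R}^d$, given past controls $u_{t-J+1},\dots,u_t\in\mathbb{R}^c$, and a control $u\in\mathbb{R}^c$ to be chosen. Let $M_t\in\mathbb{R}^{d\times m}$, let $K_t\in\mathbb{R}^{m\times m}$ and $Q_t\in\mathbb{R}^{d\times d}$ be symmetric positive definite, and let $n_t>d-1$ be real. Given the past, let $V$ have the inverted Wishart density $$\frac{1}{Z_{n_t,d}}\,\frac{1}{|V|^{(d+1)/2}}\left|\frac{V^{-1}Q_t}{2}\right|^{n_t/2}\exp\!\left(-\tfrac12\mathrm{tr}(V^{-1}Q_t)\right),\qquad Z_{n,d}=\pi^{d(d-1)/4}\prod_{i=1}^d\Gamma\!\left(\tfrac{n+1-i}{2}\right),$$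 on positive definite matrices (with respect to Lebesgue measure in the entries on and above the diagonal); given $V$, let $A$ have the matrix normal density $$\frac{|K_t|^{d/2}}{|2\pi V|^{m/2}}\exp\!\left(-\tfrac12\mathrm{tr}\big((A-M_t)^TV^{-1}(A-M_t)K_t\big)\right),$$ and let $e_{t+1}$ be $\mathcal N(0,V)$, independent of $A$ given $V$. For $x\in\mathbb{R}^m$ and $y_{t+1}=Ax+e_{t+1}$, let $I(\theta,y_{t+1};x)$ be the mutual information of $\theta$ and $y_{t+1}$ (the Kullback–Leibler divergence of their joint law from the product of the marginals), let $H(\theta)$ be the differential entropy of $\theta$, and let $H(\theta\mid y_{t+1};x)=\int p(y\mid x)\,H(\theta;x,y)\,dy$, where $p(y\mid x)$ is the predictive density of $y_{t+1}$ and $H(\theta;x,y)$ is the differential entropy of the posterior density of $\theta$ after observing $y_{t+1}=y$. Then the above defines a probability distribution, the predictive density is finite and positive everywhere, all entropies and integrals above are finite, and: (1) there is a constant $g$ depending only on $Q_t$, $n_t$ and the dimensions (not on $M_t$, $K_t$ or $x$) such that for every $x\in\mathbb{R}^m$ $$H(\theta\mid y_{t+1};x)=-\tfrac d2\ln|xx^T+K_t|+g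 ;$$ (2) for every $x\in\mathbb{R}^m$, $I(\theta,y_{t+1};x)$ is finite and equals $H(\theta)-H(\theta\mid y_{t+1};x)$; (3) for every bounded set $\mathcal U\subset\mathbb{R}^c$ of admissible controls, the following sets of optimizers coincide: $$\arg\max_{u\in\mathcal U} I(\theta,y_{t+1};x(u))=\arg\min_{u\in\mathcal U}H(\theta\mid y_{t+1};x(u))=\arg\min_{u\in\mathcal U}\left(-\tfrac d2\ln|x(u)x(u)^T+K_t|\right)=\arg\max_{u\in\mathcal U}x(u)^TK_t^{-1}x(u);$$ moreover $x(u)^TK_t^{-1}x(u)$ is bounded above on $\mathcal U$, and if $\mathcal U$ is also nonempty and closed, then these sets are nonempty. -/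

import Mathlib

open MeasureTheory Matrix

noncomputable section

namespace Infomax

/-! ### Generic notions -/

/-- The set of maximizers of `f` over `U`. -/
def argmaxOn {α β : Type*} [Preorder β] (f : α → β) (U : Set α) : Set α :=
  {u | u ∈ U ∧ IsMaxOn f U u}

/-- The set of minimizers of `f` over `U`. -/
def argminOn {α β : Type*} [Preorder β] (f : α → β) (U : Set α) : Set α :=
  {u | u ∈ U ∧ IsMinOn f U u}

/-- Mutual information of the random variables `X` and `Y`: the Kullback-Leibler divergence of
their joint law from the product of their marginal laws. -/
def mutualInfo {Ω α β : Type*} [MeasurableSpace Ω] [MeasurableSpace α] [MeasurableSpace β]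
    (P : Measure Ω) (X : Ω → α) (Y : Ω → β) : ENNReal :=
  InformationTheory.klDiv (P.map fun ω => (X ω, Y ω)) ((P.map X).prod (P.map Y))

/-- Differential entropy (in nats) of the density `p` with respect to `volume`. -/
def entropy {α : Type*} [MeasureSpace α] (p : α → ℝ) : ℝ :=
  -∫ a, p a * Real.log (p a)

/-! ### The parameter space -/

/-- Coordinates of a symmetric `d × d` matrix: its entries on and above the diagonal. -/
abbrev SymCoord (d : ℕ) : Type := {p : Fin d × Fin d // p.1 ≤ p.2} → ℝ

/-- The symmetric matrix with the given entries on and above the diagonal. -/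
def symMat {d : ℕ} (v : SymCoord d) : Matrix (Fin d) (Fin d) ℝ :=
  Matrix.of fun i j => v ⟨(min i j, max i j), min_le_max⟩

/-- Values of `θ = (A, V)`, with `A` a `d × ι` matrix and the symmetric matrix `V` given by its
`d (d + 1) / 2` free entries; `volume` is the Lebesgue measure `dA dV`. -/
abbrev Param (d : ℕ) (ι : Type) : Type := (Fin d → ι → ℝ) × SymCoord d

section Densities

variable {d : ℕ} {ι : Type} [Fintype ι] [DecidableEq ι]

/-- The coefficient matrix `A` of `θ`. -/
def Param.A (θ : Param d ι) : Matrix (Fin d) ι ℝ := Matrix.of θ.1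

/-- The noise covariance matrix `V` of `θ`. -/
def Param.V (θ : Param d ι) : Matrix (Fin d) (Fin d) ℝ := symMat θ.2

/-- Density at `y` of the normal distribution on `ℝ^d` with mean `μ` and covariance `V`. -/
def normalDensity (y μ : Fin d → ℝ) (V : Matrix (Fin d) (Fin d) ℝ) : ℝ :=
  1 / ((2 * Real.pi) • V).det ^ ((1 : ℝ) / 2) *
    Real.exp (-(1 / 2) * ((y - μ) ⬝ᵥ (V⁻¹ *ᵥ (y - μ))))

/-- Density at `A` of the matrix normal distribution with mean `M`, row covariance `V` and
precision parameter `K`. -/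
def matrixNormalDensity (A M : Matrix (Fin d) ι ℝ) (V : Matrix (Fin d) (Fin d) ℝ)
    (K : Matrix ι ι ℝ) : ℝ :=
  K.det ^ ((d : ℝ) / 2) / ((2 * Real.pi) • V).det ^ ((Fintype.card ι : ℝ) / 2) *
    Real.exp (-(1 / 2) * ((A - M)ᵀ * V⁻¹ * (A - M) * K).trace)

/-- `Z_{n,d} = π^{d(d-1)/4} ∏_{i=1}^d Γ((n+1-i)/2)`. -/
def wishartZ (n : ℝ) (d : ℕ) : ℝ :=
  Real.pi ^ ((d : ℝ) * ((d : ℝ) - 1) / 4) *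
    ∏ i ∈ Finset.Icc 1 d, Real.Gamma ((n + 1 - (i : ℝ)) / 2)

open Classical in
/-- Density at `V` of the inverted Wishart distribution with parameters `Q` and `n`; it is
carried by the positive definite matrices. -/
def invWishartDensity (V Q : Matrix (Fin d) (Fin d) ℝ) (n : ℝ) : ℝ :=
  if V.PosDef then
    1 / wishartZ n d * (1 / V.det ^ (((d : ℝ) + 1) / 2)) *
      (((1 : ℝ) / 2) • (V⁻¹ * Q)).det ^ (n / 2) * Real.exp (-(1 / 2) * (V⁻¹ * Q).trace)
  else 0

/-! ### The Bayesian model with current state `(M, K, Q, n)` -/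

/-- Density of the current distribution of `θ`: `V ~ IW(Q, n)` and `A | V ~ N(M, V, K)`. -/
def priorDensity (M : Matrix (Fin d) ι ℝ) (K : Matrix ι ι ℝ) (Q : Matrix (Fin d) (Fin d) ℝ)
    (n : ℝ) (θ : Param d ι) : ℝ :=
  matrixNormalDensity θ.A M θ.V K * invWishartDensity θ.V Q n

/-- Joint law of the parameters `θ = (A, V)` and the next noise `e`, where `e | V ~ N(0, V)`,
independent of `A` given `V`. -/
def modelLaw (M : Matrix (Fin d) ι ℝ) (K : Matrix ι ι ℝ) (Q : Matrix (Fin d) (Fin d) ℝ)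
    (n : ℝ) : Measure (Param d ι × (Fin d → ℝ)) :=
  volume.withDensity fun ω =>
    ENNReal.ofReal (priorDensity M K Q n ω.1 * normalDensity ω.2 0 ω.1.V)

/-- The next output `y = A x + e`, as a random variable on the space of `(θ, e)`. -/
def output (x : ι → ℝ) (ω : Param d ι × (Fin d → ℝ)) : Fin d → ℝ :=
  ω.1.A *ᵥ x + ω.2

/-- Mutual information between `θ` and the next output `y` when the regressor is `x`. -/
def infoGain (M : Matrix (Fin d) ι ℝ) (K : Matrix ι ι ℝ) (Q : Matrix (Fin d) (Fin d) ℝ)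
    (n : ℝ) (x : ι → ℝ) : ENNReal :=
  mutualInfo (modelLaw M K Q n) Prod.fst (output x)

/-- Joint density of `(θ, y)`, i.e. the prior times `P(y | A, x, V) = N(A x, V)`. -/
def jointDensity (M : Matrix (Fin d) ι ℝ) (K : Matrix ι ι ℝ) (Q : Matrix (Fin d) (Fin d) ℝ)
    (n : ℝ) (x : ι → ℝ) (y : Fin d → ℝ) (θ : Param d ι) : ℝ :=
  normalDensity y (θ.A *ᵥ x) θ.V * priorDensity M K Q n θ

/-- Predictive density `p(y | x)` of the next output. -/
def predictiveDensity (M : Matrix (Fin d) ι ℝ) (K : Matrix ι ι ℝ)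
    (Q : Matrix (Fin d) (Fin d) ℝ) (n : ℝ) (x : ι → ℝ) (y : Fin d → ℝ) : ℝ :=
  ∫ θ, jointDensity M K Q n x y θ

/-- Posterior density of `θ` after observing `y`, by Bayes' rule. -/
def posteriorDensity (M : Matrix (Fin d) ι ℝ) (K : Matrix ι ι ℝ)
    (Q : Matrix (Fin d) (Fin d) ℝ) (n : ℝ) (x : ι → ℝ) (y : Fin d → ℝ) (θ : Param d ι) : ℝ :=
  jointDensity M K Q n x y θ / predictiveDensity M K Q n x y

/-- Conditional entropy `H(θ | y; x)`: the expected entropy of the posterior. -/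
def expectedPosteriorEntropy (M : Matrix (Fin d) ι ℝ) (K : Matrix ι ι ℝ)
    (Q : Matrix (Fin d) (Fin d) ℝ) (n : ℝ) (x : ι → ℝ) : ℝ :=
  ∫ y, predictiveDensity M K Q n x y * entropy (posteriorDensity M K Q n x y)

end Densities

/-! ### The regressor -/

/-- Index set of the regressor: `I + 1` past activities in `ℝ^d` and `J + 1` controls in `ℝ^c`. -/
abbrev RegIdx (d c I J : ℕ) : Type := (Fin (I + 1) × Fin d) ⊕ (Fin (J + 1) × Fin c)

/-- The regressor `x_{t+1} = [r_{t-I}; …; r_t; u_{t-J+1}; …; u_t; u]`, where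
`r i = r_{t-I+i}`, `uPast j = u_{t-J+1+j}`, and `u` is the control to be chosen. -/
def regressor {d c I J : ℕ} (r : Fin (I + 1) → Fin d → ℝ) (uPast : Fin J → Fin c → ℝ)
    (u : Fin c → ℝ) : RegIdx d c I J → ℝ :=
  Sum.elim (fun p => r p.1 p.2)
    (fun p => Fin.snoc (α := fun _ => Fin c → ℝ) uPast u p.1 p.2)

end Infomax

end

open MeasureTheory Matrix

noncomputable section

namespace Infomax

open scoped Kronecker

/-! ### Gaussian integrals -/

/-! The normal-inverse-Wishart family is conjugate. Completing the square in `A` writes the joint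
density of `θ` and `y` as a function of `y` times a member of the family with parameters `K' = x xᵀ
+ K`, `Q' = Q + w wᵀ` and `n + 1`, where `w = √(|K| / |K'|) (y - M x)` (`jointDensity_eq`). Members
integrate to one, so the first factor is the predictive density and the second the posterior.
Normalization comes from the inverse Wishart integral, by induction on the dimension through Schur
complements (`lintegral_invWishartKernel`).

With `K = Bᵀ B`, the map `A ↦ (A - M) Bᵀ` has Jacobian `|K|^(d/2)` and carries a member to the one
with mean `0` and precision `1`. Its entropy is therefore `-(d/2) log |K|` plus a term in `Q` and
`n` only (`entropy_priorDensity`). For the posterior the first term is `-(d/2) log |K'|`, which is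
free of `y`. The second is a function of `w`, whose law is free of `M`, `K` and `x`; its mean is the
constant `g` (`expectedPosteriorEntropy_eq`).

All integrability rests on `|p log p| ≤ δ⁻¹ (p^(1+δ) + p^(1-δ))`: powers of a member are again
kernels of the family, so the bound has an explicit integral, which for small `δ` remains integrable
in `y`. Once both entropies converge absolutely, the logarithm in the divergence splits into log
posterior minus log prior (`infoGain_ne_top_and_toReal_eq`).

Finally `|x xᵀ + K| = |K| (1 + xᵀ K⁻¹ x)`, so all four objectives order the regressors in the same
way, up to reversal, and share their optimizers. -/

theorem exists_transpose_mul_self_of_posDef {κ : Type*} [Fintype κ] [DecidableEq κ]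
    {P : Matrix κ κ ℝ} (hP : P.PosDef) : ∃ B : Matrix κ κ ℝ, P = Bᵀ * B ∧ B.det ≠ 0 := by
  open scoped MatrixOrder in
  obtain ⟨B, hB⟩ := CStarAlgebra.nonneg_iff_eq_star_mul_self.mp hP.posSemidef.nonneg
  have hB' : P = Bᵀ * B := by
    rw [hB, star_eq_conjTranspose, conjTranspose_eq_transpose_of_trivial]
  refine ⟨B, hB', fun h => hP.det_pos.ne' ?_⟩
  rw [hB', det_mul, h, mul_zero]

theorem lintegral_comp_mulVec {κ : Type*} [Fintype κ] [DecidableEq κ] {B : Matrix κ κ ℝ}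
    (hB : B.det ≠ 0) {f : (κ → ℝ) → ENNReal} (hf : Measurable f) :
    ∫⁻ x, f (B *ᵥ x) = ENNReal.ofReal |B.det⁻¹| * ∫⁻ x, f x := by
  have h := Real.map_matrix_volume_pi_eq_smul_volume_pi hB
  calc ∫⁻ x, f (B *ᵥ x) = ∫⁻ x, f x ∂(Measure.map (toLin' B) volume) := by
        rw [lintegral_map hf (toLin' B).continuous_of_finiteDimensional.measurable]
        rfl
    _ = _ := by rw [h, lintegral_smul_measure, smul_eq_mul]

theorem lintegral_exp_neg_half_dotProduct_self (κ : Type*) [Fintype κ] :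
    ∫⁻ x : κ → ℝ, ENNReal.ofReal (Real.exp (-(1 / 2) * (x ⬝ᵥ x))) =
      ENNReal.ofReal ((2 * Real.pi) ^ ((Fintype.card κ : ℝ) / 2)) := by
  have hprod : (fun x : κ → ℝ => Real.exp (-(1 / 2) * (x ⬝ᵥ x))) =
      fun x => ∏ i, Real.exp (-(1 / 2) * x i ^ 2) := by
    ext x
    rw [← Real.exp_sum, dotProduct, Finset.mul_sum]
    simp only [sq]
  have hint : Integrable (fun x : κ → ℝ => Real.exp (-(1 / 2) * (x ⬝ᵥ x))) := by
    rw [hprod]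
    exact Integrable.fintype_prod (f := fun _ (t : ℝ) => Real.exp (-(1 / 2) * t ^ 2))
      fun _ => integrable_exp_neg_mul_sq (by norm_num)
  rw [← ofReal_integral_eq_lintegral_ofReal hint (ae_of_all _ fun _ => (Real.exp_pos _).le), hprod,
    integral_fintype_prod_volume_eq_pow (fun t : ℝ => Real.exp (-(1 / 2) * t ^ 2)),
    integral_gaussian]
  congr 1
  rw [Real.sqrt_eq_rpow, ← Real.rpow_natCast, ← Real.rpow_mul (by positivity)]
  congr 1
  · ring
  · ring

/-- With `P = Bᵀ B` the form is the squared length of `B x`, and the substitution costs `|det B|⁻¹ =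
|P|^(-1/2)`. -/
theorem lintegral_gaussian {κ : Type*} [Fintype κ] [DecidableEq κ] {P : Matrix κ κ ℝ}
    (hP : P.PosDef) (μ : κ → ℝ) :
    ∫⁻ x : κ → ℝ, ENNReal.ofReal (Real.exp (-(1 / 2) * ((x - μ) ⬝ᵥ (P *ᵥ (x - μ))))) =
      ENNReal.ofReal ((2 * Real.pi) ^ ((Fintype.card κ : ℝ) / 2) * P.det ^ (-(1 / 2) : ℝ)) := by
  obtain ⟨B, hPB, hB⟩ := exists_transpose_mul_self_of_posDef hP
  rw [lintegral_sub_right_eq_self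
    (fun x : κ → ℝ => ENNReal.ofReal (Real.exp (-(1 / 2) * (x ⬝ᵥ (P *ᵥ x))))) μ]
  have h1 : ∀ x : κ → ℝ, x ⬝ᵥ (P *ᵥ x) = (B *ᵥ x) ⬝ᵥ (B *ᵥ x) := fun x => by
    rw [hPB, ← mulVec_mulVec, dotProduct_mulVec, vecMul_transpose]
  simp_rw [h1]
  rw [lintegral_comp_mulVec hB
    (f := fun x => ENNReal.ofReal (Real.exp (-(1 / 2) * (x ⬝ᵥ x)))) (by fun_prop),
    lintegral_exp_neg_half_dotProduct_self, ← ENNReal.ofReal_mul (abs_nonneg _), mul_comm]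
  congr 2
  rw [hPB, det_mul, det_transpose, ← sq, ← sq_abs, ← Real.rpow_natCast,
    ← Real.rpow_mul (abs_nonneg _), abs_inv, ← Real.rpow_neg_one]
  norm_num

/-- Identifies Lebesgue measure on matrices with that on vectors indexed by pairs, so that Kronecker
products can be applied. -/
theorem measurePreserving_curry (α β : Type*) [Fintype α] [Fintype β] :
    MeasurePreserving (MeasurableEquiv.curry α β ℝ) volume volume := by
  refine MeasurePreserving.symm (MeasurableEquiv.curry α β ℝ).symm
    ⟨(MeasurableEquiv.curry α β ℝ).symm.measurable, ?_⟩
  symm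
  refine Measure.pi_eq fun s _ => ?_
  rw [MeasurableEquiv.map_apply]
  have : (MeasurableEquiv.curry α β ℝ).symm ⁻¹' Set.univ.pi s =
      Set.univ.pi fun i => Set.univ.pi fun j => s (i, j) := by
    ext f
    simp [MeasurableEquiv.curry, Set.mem_pi, Function.uncurry]
  rw [this, volume_pi_pi]
  simp_rw [volume_pi_pi]
  rw [Fintype.prod_prod_type]

/-- Right multiplication by `C` scales the Lebesgue measure on `d × ι` matrices by `|C|^d`. -/
theorem map_mul_right_volume {α β : Type*} [Fintype α] [Fintype β] [DecidableEq α] [DecidableEq β]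
    {C : Matrix β β ℝ} (hC : C.det ≠ 0) :
    Measure.map (fun A : α → β → ℝ => fun i => A i ᵥ* C) volume =
      ENNReal.ofReal ((|C.det| ^ Fintype.card α)⁻¹) • volume := by
  -- On vectorized matrices, right multiplication by `C` is `1 ⊗ Cᵀ`.
  have hdet : ((1 : Matrix α α ℝ) ⊗ₖ Cᵀ).det = C.det ^ Fintype.card α := by
    rw [det_kronecker]; simp
  have hne : ((1 : Matrix α α ℝ) ⊗ₖ Cᵀ).det ≠ 0 := by rw [hdet]; positivity
  have h := Real.map_matrix_volume_pi_eq_smul_volume_pi hne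
  have hcomp : (fun A : α → β → ℝ => fun i => A i ᵥ* C) =
      MeasurableEquiv.curry α β ℝ ∘ toLin' ((1 : Matrix α α ℝ) ⊗ₖ Cᵀ) ∘
        (MeasurableEquiv.curry α β ℝ).symm := by
    ext A i j
    simp [MeasurableEquiv.curry, mulVec, dotProduct, vecMul, Fintype.sum_prod_type,
      kroneckerMap_apply, one_apply, Function.uncurry, Function.curry, Finset.sum_ite_eq, mul_comm]
  have hm : Measurable (toLin' ((1 : Matrix α α ℝ) ⊗ₖ Cᵀ)) :=
    (toLin' ((1 : Matrix α α ℝ) ⊗ₖ Cᵀ)).continuous_of_finiteDimensional.measurable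
  rw [hcomp, ← Measure.map_map (MeasurableEquiv.measurable _)
    (hm.comp (MeasurableEquiv.measurable _)), ← Measure.map_map hm (MeasurableEquiv.measurable _),
    (measurePreserving_curry α β).symm.map_eq, h, Measure.map_smul,
    (measurePreserving_curry α β).map_eq, hdet, abs_inv, abs_pow]

/-- After vectorizing, the trace is the quadratic form of `P ⊗ K`, whose determinant is `|P|^|β|
|K|^|α|`; the vector Gaussian integral then applies. -/
theorem lintegral_matrix_gaussian {α β : Type*} [Fintype α] [Fintype β] [DecidableEq α]
    [DecidableEq β] {P : Matrix α α ℝ} {K : Matrix β β ℝ} (hP : P.PosDef) (hK : K.PosDef)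
    (M : Matrix α β ℝ) :
    ∫⁻ A : α → β → ℝ, ENNReal.ofReal (Real.exp (-(1 / 2) *
        ((Matrix.of A - M)ᵀ * P * (Matrix.of A - M) * K).trace)) =
      ENNReal.ofReal ((2 * Real.pi) ^ ((Fintype.card α : ℝ) * Fintype.card β / 2) *
        P.det ^ (-(Fintype.card β : ℝ) / 2) * K.det ^ (-(Fintype.card α : ℝ) / 2)) := by
  rw [← (measurePreserving_curry α β).lintegral_comp_emb (MeasurableEquiv.measurableEmbedding _)]
  have key : ∀ x : α × β → ℝ,
      ((Matrix.of (MeasurableEquiv.curry α β ℝ x) - M)ᵀ * P *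
        (Matrix.of (MeasurableEquiv.curry α β ℝ x) - M) * K).trace =
      (x - Function.uncurry M) ⬝ᵥ ((P ⊗ₖ K) *ᵥ (x - Function.uncurry M)) := by
    intro x
    have hKs : ∀ i j, K i j = K j i := fun i j => by
      have := hK.isHermitian.apply i j
      simpa using this.symm
    set D : Matrix α β ℝ := Matrix.of (MeasurableEquiv.curry α β ℝ x) - M with hD
    have hx : x - Function.uncurry M = Function.uncurry D := by
      ext ⟨i, j⟩
      rfl
    rw [hx, Matrix.mul_assoc, Matrix.mul_assoc, trace, Finset.sum_congr rfl fun j _ => diag_apply _ j]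
    simp only [Matrix.mul_apply (M := Dᵀ), transpose_apply, dotProduct, Fintype.sum_prod_type]
    rw [Finset.sum_comm]
    refine Finset.sum_congr rfl fun i _ => Finset.sum_congr rfl fun j _ => ?_
    simp only [mulVec, dotProduct, Fintype.sum_prod_type, kroneckerMap_apply, Matrix.mul_apply,
      Function.uncurry, Finset.mul_sum]
    refine Finset.sum_congr rfl fun k _ => Finset.sum_congr rfl fun l _ => ?_
    rw [hKs j l]
    ring
  simp_rw [key]
  rw [lintegral_gaussian (hP.kronecker hK), det_kronecker]
  congr 1
  rw [Real.mul_rpow (x := P.det ^ _) (by have := hP.det_pos; positivity)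
      (by have := hK.det_pos; positivity), ← Real.rpow_natCast, ← Real.rpow_natCast, ← Real.rpow_mul hP.det_pos.le,
    ← Real.rpow_mul hK.det_pos.le, Fintype.card_prod, mul_assoc]
  congr 2
  · push_cast; ring
  · congr 1; ring
  · congr 1; ring

/-! ### The inverse gamma integral -/

/-- The substitution `t = 1 / s` in Euler's Gamma integral. -/
theorem lintegral_inverse_gamma {a q : ℝ} (ha : 0 < a) (hq : 0 < q) :
    ∫⁻ s in Set.Ioi (0 : ℝ), ENNReal.ofReal (s ^ (-1 - a) * Real.exp (-(q / s))) =
      ENNReal.ofReal (q ^ (-a) * Real.Gamma a) := by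
  have hval := Real.integral_rpow_mul_exp_neg_mul_Ioi ha hq
  -- A non-integrable function has integral `0` by convention, whereas the known value is positive.
  have hint : IntegrableOn (fun t : ℝ => t ^ (a - 1) * Real.exp (-(q * t))) (Set.Ioi 0) := by
    by_contra h
    rw [integral_undef h] at hval
    have : 0 < (1 / q) ^ a * Real.Gamma a :=
      mul_pos (by positivity) (Real.Gamma_pos_of_pos ha)
    exact this.ne hval
  have hcongr : ∀ s ∈ Set.Ioi (0 : ℝ), (|(-1 : ℝ)| * s ^ ((-1 : ℝ) - 1)) •
      ((s ^ (-1 : ℝ)) ^ (a - 1) * Real.exp (-(q * s ^ (-1 : ℝ)))) =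
        s ^ (-1 - a) * Real.exp (-(q / s)) := by
    intro s hs
    have hs : 0 < s := hs
    rw [← Real.rpow_mul hs.le, smul_eq_mul, abs_neg, abs_one, one_mul, ← mul_assoc,
      ← Real.rpow_add hs, Real.rpow_neg_one, div_eq_mul_inv]
    congr 2
    ring
  have hint' := (integrableOn_Ioi_comp_rpow_iff _ (p := -1) (by norm_num)).mpr hint
  have hval' := integral_comp_rpow_Ioi
    (fun t : ℝ => t ^ (a - 1) * Real.exp (-(q * t))) (p := -1) (by norm_num)
  rw [setIntegral_congr_fun measurableSet_Ioi hcongr, hval] at hval'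
  rw [integrableOn_congr_fun hcongr measurableSet_Ioi] at hint'
  rw [← ofReal_integral_eq_lintegral_ofReal hint', hval', one_div, Real.inv_rpow hq.le,
    Real.rpow_neg hq.le]
  filter_upwards [ae_restrict_mem measurableSet_Ioi] with s hs
  have hs : 0 < s := hs
  positivity

/-! ### Block decomposition of symmetric matrices -/

section Block

set_option linter.unusedSectionVars false

variable {κ : Type*} [Fintype κ] [DecidableEq κ]

/-- The block matrix `[1, βᵀ; 0, 1]`. -/
def shearMat (β : κ → ℝ) : Matrix (Unit ⊕ κ) (Unit ⊕ κ) ℝ :=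
  fromBlocks 1 (replicateRow Unit β) 0 1

/-- The block diagonal matrix with blocks `s` and `C`. -/
def scalarBlock (s : ℝ) (C : Matrix κ κ ℝ) : Matrix (Unit ⊕ κ) (Unit ⊕ κ) ℝ :=
  fromBlocks (diagonal fun _ => s) 0 0 C

/-- The symmetric block matrix with lower right block `C`, Schur complement `s` and off-diagonal
block `C β`. -/
def schurBlock (s : ℝ) (β : κ → ℝ) (C : Matrix κ κ ℝ) : Matrix (Unit ⊕ κ) (Unit ⊕ κ) ℝ :=
  shearMat β * scalarBlock s C * (shearMat β)ᵀ

theorem shearMat_mul (β γ : κ → ℝ) : shearMat β * shearMat γ = shearMat (β + γ) := by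
  simp [shearMat, fromBlocks_multiply, add_comm, replicateRow_add]

theorem shearMat_zero : shearMat (0 : κ → ℝ) = 1 := by
  simp [shearMat]

theorem det_shearMat (β : κ → ℝ) : (shearMat β).det = 1 := by
  simp [shearMat]

theorem det_schurBlock (s : ℝ) (β : κ → ℝ) (C : Matrix κ κ ℝ) :
    (schurBlock s β C).det = s * C.det := by
  simp [schurBlock, det_shearMat, scalarBlock]

theorem schurBlock_eq {C : Matrix κ κ ℝ} (hC : Cᵀ = C) (s : ℝ) (β : κ → ℝ) :
    schurBlock s β C = fromBlocks (diagonal fun _ => s + β ⬝ᵥ (C *ᵥ β))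
      (replicateRow Unit (C *ᵥ β)) (replicateCol Unit (C *ᵥ β)) C := by
  have hv : β ᵥ* C = C *ᵥ β := by
    conv_rhs => rw [← hC, mulVec_transpose]
  simp only [schurBlock, shearMat, scalarBlock, fromBlocks_multiply, fromBlocks_transpose]
  congr 1
  · ext i j
    rw [← replicateRow_vecMul]
    simp [hv, vecMul, ← replicateRow_vecMul, dotProduct, mul_comm]
  · simp [← replicateRow_vecMul, hv]
  · simp [← replicateCol_mulVec]
  · simp

theorem inv_schurBlock {s : ℝ} (hs : s ≠ 0) (β : κ → ℝ) {C : Matrix κ κ ℝ} (hC : C.det ≠ 0) :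
    (schurBlock s β C)⁻¹ = (shearMat (-β))ᵀ * scalarBlock s⁻¹ C⁻¹ * shearMat (-β) := by
  refine inv_eq_right_inv ?_
  have h1 : (shearMat β)ᵀ * (shearMat (-β))ᵀ = 1 := by
    rw [← transpose_mul, shearMat_mul, neg_add_cancel, shearMat_zero, transpose_one]
  have h2 : scalarBlock s C * scalarBlock s⁻¹ C⁻¹ = 1 := by
    simp [scalarBlock, fromBlocks_multiply, hs, mul_nonsing_inv C (isUnit_iff_ne_zero.mpr hC)]
  calc _ = shearMat β * (scalarBlock s C * ((shearMat β)ᵀ * (shearMat (-β))ᵀ) *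
      scalarBlock s⁻¹ C⁻¹) * shearMat (-β) := by
        simp only [schurBlock, Matrix.mul_assoc]
    _ = 1 := by rw [h1, Matrix.mul_one, h2, Matrix.mul_one, shearMat_mul, add_neg_cancel,
        shearMat_zero]

/-- Cyclicity of the trace moves the shears of the inverse onto the second matrix, where they only
shift `γ` to `γ - β`. What remains is block diagonal against a full block, so the trace separates
into a `C` part and a part quadratic in `β`. -/
theorem trace_inv_schurBlock_mul {s : ℝ} (hs : s ≠ 0) (β : κ → ℝ) {C : Matrix κ κ ℝ}
    (hC : C.det ≠ 0) (q : ℝ) (γ : κ → ℝ) {R : Matrix κ κ ℝ} (hR : Rᵀ = R) :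
    ((schurBlock s β C)⁻¹ * schurBlock q γ R).trace =
      (C⁻¹ * R).trace + (q + (β - γ) ⬝ᵥ (R *ᵥ (β - γ))) / s := by
  have h1 : shearMat (-β) * schurBlock q γ R * (shearMat (-β))ᵀ = schurBlock q (-β + γ) R := by
    simp only [schurBlock, ← shearMat_mul, transpose_mul, Matrix.mul_assoc]
  have h2 : ((schurBlock s β C)⁻¹ * schurBlock q γ R).trace =
      (scalarBlock s⁻¹ C⁻¹ * schurBlock q (-β + γ) R).trace := by
    rw [inv_schurBlock hs β hC, ← h1]
    simp only [Matrix.mul_assoc]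
    rw [trace_mul_comm]
    simp only [Matrix.mul_assoc]
  have h3 : -β + γ = -(β - γ) := by abel
  rw [h2, schurBlock_eq hR, scalarBlock, fromBlocks_multiply, h3, mulVec_neg,
    neg_dotProduct, dotProduct_neg, neg_neg]
  simp [Matrix.trace, div_eq_inv_mul, add_comm]

/-- A shear is invertible, so congruence reduces the claim to the block diagonal matrix. -/
theorem posDef_schurBlock_iff {C : Matrix κ κ ℝ} (hC : C.PosDef) (s : ℝ) (β : κ → ℝ) :
    (schurBlock s β C).PosDef ↔ 0 < s := by
  have hu : IsUnit (shearMat β) := by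
    rw [isUnit_iff_isUnit_det, det_shearMat]; exact isUnit_one
  have h : schurBlock s β C = shearMat β * scalarBlock s C * star (shearMat β) := by
    rw [schurBlock, star_eq_conjTranspose, conjTranspose_eq_transpose_of_trivial]
  rw [h, Matrix.IsUnit.posDef_star_right_conjugate_iff hu]
  constructor
  · intro hp
    have := hp.diag_pos (i := Sum.inl ())
    simpa [scalarBlock] using this
  · intro hs
    let _ := hC.isUnit.invertible
    have hps : (scalarBlock s C).PosSemidef := by
      have := (PosDef.fromBlocks₂₂ (diagonal fun _ : Unit => s) 0 hC).mpr (by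
        simpa using hs.le)
      simpa [scalarBlock] using this
    rw [hps.posDef_iff_det_ne_zero]
    simp [scalarBlock, hs.ne', hC.det_pos.ne']

end Block

/-! ### Coordinates of symmetric matrices -/

theorem symMat_transpose {d : ℕ} (v : SymCoord d) : (symMat v)ᵀ = symMat v := by
  ext i j
  simp [symMat, min_comm, max_comm]

/-- Entries on and above the diagonal, split into the corner, the rest of the first row, and the
entries of the lower right block. -/
def triIdxEquiv (d : ℕ) : Unit ⊕ (Fin d ⊕ {p : Fin d × Fin d // p.1 ≤ p.2}) ≃
    {p : Fin (d + 1) × Fin (d + 1) // p.1 ≤ p.2} :=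
  Equiv.ofBijective
    (Sum.elim (fun _ => ⟨(0, 0), le_rfl⟩) (Sum.elim (fun j => ⟨(0, j.succ), Fin.zero_le _⟩)
      fun p => ⟨(p.1.1.succ, p.1.2.succ), Fin.succ_le_succ_iff.mpr p.2⟩)) <| by
    constructor
    · rintro (_ | i | ⟨⟨i, j⟩, h⟩) (_ | i' | ⟨⟨i', j'⟩, h'⟩) <;>
        simp [Fin.succ_ne_zero, (Fin.succ_ne_zero _).symm, Subtype.ext_iff, Prod.ext_iff]
    · rintro ⟨⟨i, j⟩, h⟩
      cases i using Fin.cases with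
      | zero =>
        cases j using Fin.cases with
        | zero => exact ⟨Sum.inl (), rfl⟩
        | succ j => exact ⟨Sum.inr (Sum.inl j), rfl⟩
      | succ i =>
        cases j using Fin.cases with
        | zero => simp at h
        | succ j => exact ⟨Sum.inr (Sum.inr ⟨(i, j), Fin.succ_le_succ_iff.mp h⟩), rfl⟩

/-- Coordinates of the symmetric matrix `[a, bᵀ; b, C]`, with `C` given by its coordinates. -/
def symGlue {d : ℕ} (a : ℝ) (b : Fin d → ℝ) (c : SymCoord d) : SymCoord (d + 1) :=
  fun p => Sum.elim (fun _ => a) (Sum.elim b c) ((triIdxEquiv d).symm p)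

theorem symGlue_apply {d : ℕ} (a : ℝ) (b : Fin d → ℝ) (c : SymCoord d) (i) :
    symGlue a b c (triIdxEquiv d i) = Sum.elim (fun _ => a) (Sum.elim b c) i := by
  simp [symGlue]

theorem measurable_symGlue {d : ℕ} :
    Measurable fun p : ℝ × (Fin d → ℝ) × SymCoord d => symGlue p.1 p.2.1 p.2.2 := by
  refine measurable_pi_lambda _ fun p => ?_
  obtain ⟨i, rfl⟩ := (triIdxEquiv d).surjective p
  simp only [symGlue_apply]
  rcases i with _ | i | i <;> simp only [Sum.elim_inl, Sum.elim_inr] <;> fun_prop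

/-- The equivalence `Unit ⊕ Fin d ≃ Fin (d + 1)` sending the first summand to `0`. -/
def unitSumFin (d : ℕ) : Unit ⊕ Fin d ≃ Fin (d + 1) :=
  ((finSuccEquiv d).trans ((Equiv.optionEquivSumPUnit (Fin d)).trans (Equiv.sumComm _ _))).symm

@[simp] theorem unitSumFin_inl (d : ℕ) (u : Unit) : unitSumFin d (Sum.inl u) = 0 := by
  simp [unitSumFin]

@[simp] theorem unitSumFin_inr (d : ℕ) (i : Fin d) : unitSumFin d (Sum.inr i) = i.succ := by
  simp [unitSumFin]

theorem symMat_symGlue {d : ℕ} (a : ℝ) (b : Fin d → ℝ) (c : SymCoord d) :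
    (symMat (symGlue a b c)).submatrix (unitSumFin d) (unitSumFin d) =
      fromBlocks (diagonal fun _ => a) (replicateRow Unit b) (replicateCol Unit b) (symMat c) := by
  have h0 : symGlue a b c ⟨(0, 0), le_rfl⟩ = a := symGlue_apply a b c (Sum.inl ())
  have h1 : ∀ j : Fin d, symGlue a b c ⟨(0, j.succ), Fin.zero_le _⟩ = b j :=
    fun j => symGlue_apply a b c (Sum.inr (Sum.inl j))
  have h2 : ∀ p : {p : Fin d × Fin d // p.1 ≤ p.2}, symGlue a b c
      ⟨(p.1.1.succ, p.1.2.succ), Fin.succ_le_succ_iff.mpr p.2⟩ = c p :=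
    fun p => symGlue_apply a b c (Sum.inr (Sum.inr p))
  ext (i | i) (j | j)
  · simpa [symMat] using h0
  · simpa [symMat] using h1 j
  · simpa [symMat] using h1 i
  · simp only [submatrix_apply, unitSumFin_inr, fromBlocks_apply₂₂, symMat, of_apply]
    rw [← h2]
    congr 3
    · exact (Fin.strictMono_succ.monotone.map_min).symm
    · exact (Fin.strictMono_succ.monotone.map_max).symm

/-- Tonelli in the order that suits Schur complements: with the block `c` and the row `b` fixed, the
corner `a` is innermost and differs from the Schur complement by a constant. -/
theorem lintegral_symCoord_succ {d : ℕ} {f : SymCoord (d + 1) → ENNReal} (hf : Measurable f) :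
    ∫⁻ v, f v = ∫⁻ c : SymCoord d, ∫⁻ b : Fin d → ℝ, ∫⁻ a : ℝ, f (symGlue a b c) := by
  have h1 := volume_measurePreserving_piCongrLeft
    (fun _ : {p : Fin (d + 1) × Fin (d + 1) // p.1 ≤ p.2} => ℝ) (triIdxEquiv d)
  have h2 := (volume_measurePreserving_sumPiEquivProdPi
    (fun _ : Unit ⊕ (Fin d ⊕ {p : Fin d × Fin d // p.1 ≤ p.2}) => ℝ)).symm
  have h3 := (volume_measurePreserving_sumPiEquivProdPi
    (fun _ : Fin d ⊕ {p : Fin d × Fin d // p.1 ≤ p.2} => ℝ)).symm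
  have h4 := (volume_preserving_funUnique Unit ℝ).symm
  have h5 := h1.comp (h2.comp (h4.prod h3))
  have hfun : ∀ p : ℝ × (Fin d → ℝ) × SymCoord d,
      symGlue p.1 p.2.1 p.2.2 = (MeasurableEquiv.piCongrLeft
        (fun _ : {p : Fin (d + 1) × Fin (d + 1) // p.1 ≤ p.2} => ℝ) (triIdxEquiv d) ∘
        (MeasurableEquiv.sumPiEquivProdPi
    (fun _ : Unit ⊕ (Fin d ⊕ {p : Fin d × Fin d // p.1 ≤ p.2}) => ℝ)).symm ∘
        Prod.map (MeasurableEquiv.funUnique Unit ℝ).symm (MeasurableEquiv.sumPiEquivProdPi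
    (fun _ : Fin d ⊕ {p : Fin d × Fin d // p.1 ≤ p.2} => ℝ)).symm) p := by
    intro p
    ext q
    obtain ⟨i, rfl⟩ := (triIdxEquiv d).surjective q
    rw [symGlue_apply]
    simp only [Function.comp_apply, MeasurableEquiv.coe_piCongrLeft, Equiv.piCongrLeft_apply_apply]
    rcases i with _ | i | i <;> rfl
  rw [← h5.lintegral_comp hf]
  simp_rw [← hfun]
  have hm : Measurable fun p : ℝ × (Fin d → ℝ) × SymCoord d => f (symGlue p.1 p.2.1 p.2.2) :=
    hf.comp measurable_symGlue
  change ∫⁻ p : ℝ × (Fin d → ℝ) × SymCoord d, f (symGlue p.1 p.2.1 p.2.2)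
    ∂(volume.prod (volume.prod volume)) = _
  rw [lintegral_prod_symm _ hm.aemeasurable, lintegral_prod_symm]
  exact (hm.lintegral_prod_left').aemeasurable

/-! ### Measurability -/

theorem continuous_symMat {d : ℕ} : Continuous (symMat : SymCoord d → Matrix (Fin d) (Fin d) ℝ) := by
  refine continuous_matrix fun i j => ?_
  simp only [symMat, of_apply]
  fun_prop

/-- The adjugate is polynomial in the entries, so this form exhibits measurability in `V` without
any invertibility assumption. -/
theorem trace_mul_inv_mul {α β : Type*} [Fintype α] [Fintype β] [DecidableEq α] (X : Matrix β α ℝ)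
    (V : Matrix α α ℝ) (Y : Matrix α β ℝ) :
    (X * V⁻¹ * Y).trace = V.det⁻¹ * (X * V.adjugate * Y).trace := by
  rw [inv_def, Ring.inverse_eq_inv', Matrix.mul_smul, Matrix.smul_mul, trace_smul, smul_eq_mul]

/-- Semidefiniteness is an intersection of closed conditions, uncountable but still closed;
definiteness adds the open condition of nonzero determinant. -/
theorem measurableSet_posDef_symMat {d : ℕ} : MeasurableSet {v : SymCoord d | (symMat v).PosDef} := by
  have h : {v : SymCoord d | (symMat v).PosDef} =
      {v | (symMat v).PosSemidef} ∩ {v | (symMat v).det ≠ 0} := by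
    ext v
    constructor
    · exact fun h => ⟨PosDef.posSemidef h, (PosDef.det_pos h).ne'⟩
    · exact fun h => (PosSemidef.posDef_iff_det_ne_zero h.1).mpr h.2
  have h1 : {v : SymCoord d | (symMat v).PosSemidef} =
      ⋂ x : Fin d → ℝ, {v | 0 ≤ x ⬝ᵥ (symMat v *ᵥ x)} := by
    ext v
    simp only [posSemidef_iff_dotProduct_mulVec, Set.mem_ofPred_eq, Set.mem_iInter, star_trivial]
    refine and_iff_right ?_
    rw [IsHermitian, conjTranspose_eq_transpose_of_trivial, symMat_transpose]
  have hc := continuous_symMat (d := d)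
  rw [h, h1]
  refine (IsClosed.measurableSet (isClosed_iInter fun x => ?_)).inter
    (IsOpen.measurableSet ?_)
  · exact isClosed_le continuous_const (by fun_prop)
  · exact isOpen_ne_fun (by fun_prop) continuous_const

theorem measurable_det_symMat {d : ℕ} : Measurable fun v : SymCoord d => (symMat v).det := by
  have hc := continuous_symMat (d := d)
  exact Continuous.measurable (by fun_prop)

/-! ### The inverse Wishart integral -/

open Classical in
/-- The inverse Wishart density up to normalization. -/
def invWishartKernel {κ : Type*} [Fintype κ] [DecidableEq κ] (ν : ℝ) (V Q : Matrix κ κ ℝ) : ℝ :=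
  if V.PosDef then V.det ^ (-ν) * Real.exp (-(1 / 2) * (V⁻¹ * Q).trace) else 0

theorem measurable_invWishartKernel {d : ℕ} (ν : ℝ) (Q : Matrix (Fin d) (Fin d) ℝ) :
    Measurable fun v : SymCoord d => invWishartKernel ν (symMat v) Q := by
  unfold invWishartKernel
  have h := fun v : SymCoord d => trace_mul_inv_mul 1 (symMat v) Q
  simp only [Matrix.one_mul] at h
  simp_rw [h]
  have hc := continuous_symMat (d := d)
  have h1 : Continuous fun v : SymCoord d => ((symMat v).adjugate * Q).trace := by fun_prop
  have h2 := measurable_det_symMat (d := d)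
  refine Measurable.ite measurableSet_posDef_symMat ?_ measurable_const
  exact (h2.pow_const _).mul ((h2.inv.mul h1.measurable).const_mul _).exp

theorem posDef_submatrix_equiv_iff {κ κ' : Type*} [Fintype κ] [Fintype κ'] (e : κ' ≃ κ)
    {V : Matrix κ κ ℝ} : (V.submatrix e e).PosDef ↔ V.PosDef := by
  refine ⟨fun h => ?_, fun h => h.submatrix e.injective⟩
  simpa using h.submatrix e.symm.injective

theorem invWishartKernel_submatrix {κ κ' : Type*} [Fintype κ] [Fintype κ'] [DecidableEq κ]
    [DecidableEq κ'] (e : κ' ≃ κ) (ν : ℝ) (V Q : Matrix κ κ ℝ) :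
    invWishartKernel ν (V.submatrix e e) (Q.submatrix e e) = invWishartKernel ν V Q := by
  have ht : ((V⁻¹ * Q).submatrix e e).trace = (V⁻¹ * Q).trace := by
    simp only [trace, diag_apply, submatrix_apply]
    exact e.sum_comp fun i => (V⁻¹ * Q) i i
  simp only [invWishartKernel, det_submatrix_equiv_self, inv_submatrix_equiv, submatrix_mul_equiv,
    ht]
  congr 1
  exact propext (posDef_submatrix_equiv_iff e)

/-- The variables separate: a factor in `C` alone, an inverse gamma factor in `s`, and a Gaussian in
`β` with precision `R / s`. -/
theorem invWishartKernel_schurBlock {κ : Type*} [Fintype κ] [DecidableEq κ] {C R : Matrix κ κ ℝ}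
    (hC : C.PosDef) (hR : Rᵀ = R) (ν s q : ℝ) (β γ : κ → ℝ) :
    invWishartKernel ν (schurBlock s β C) (schurBlock q γ R) =
      (Set.Ioi 0).indicator (fun s => (C.det ^ (-ν) * Real.exp (-(1 / 2) * (C⁻¹ * R).trace)) *
        (s ^ (-ν) * Real.exp (-((q / 2) / s)) *
          Real.exp (-(1 / 2) * ((β - γ) ⬝ᵥ ((s⁻¹ • R) *ᵥ (β - γ)))))) s := by
  unfold invWishartKernel
  simp only [posDef_schurBlock_iff hC]
  by_cases hs : 0 < s
  · rw [if_pos hs, Set.indicator_of_mem (Set.mem_Ioi.mpr hs), det_schurBlock,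
      Real.mul_rpow hs.le hC.det_pos.le]
    rw [trace_inv_schurBlock_mul hs.ne' β hC.det_pos.ne' q γ hR, smul_mulVec, dotProduct_smul,
      smul_eq_mul]
    have h3 : -(1 / 2) * ((C⁻¹ * R).trace + (q + (β - γ) ⬝ᵥ (R *ᵥ (β - γ))) / s) =
        -(1 / 2) * (C⁻¹ * R).trace + (-((q / 2) / s) +
          -(1 / 2) * (s⁻¹ * ((β - γ) ⬝ᵥ (R *ᵥ (β - γ))))) := by
      field_simp
      ring
    rw [h3, Real.exp_add, Real.exp_add]
    ring
  · rw [if_neg hs, Set.indicator_of_notMem (by simpa using hs)]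

/-- Here `R` is the lower right block, `γ` is `R⁻¹` applied to the off-diagonal column, and `q` is
the Schur complement. -/
theorem exists_eq_schurBlock {κ : Type*} [Fintype κ] [DecidableEq κ]
    {P : Matrix (Unit ⊕ κ) (Unit ⊕ κ) ℝ} (hP : P.PosDef) :
    ∃ (q : ℝ) (γ : κ → ℝ) (R : Matrix κ κ ℝ), R.PosDef ∧ 0 < q ∧ P = schurBlock q γ R := by
  have hR : (P.submatrix Sum.inr Sum.inr).PosDef := hP.submatrix Sum.inr_injective
  set R := P.submatrix (Sum.inr : κ → Unit ⊕ κ) Sum.inr with hRdef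
  have hRt : Rᵀ = R := by
    simpa [IsHermitian, conjTranspose_eq_transpose_of_trivial] using hR.isHermitian
  have hPs : ∀ i j, P i j = P j i := fun i j => by
    simpa using (hP.isHermitian.apply i j).symm
  set b : κ → ℝ := fun i => P (Sum.inr i) (Sum.inl ()) with hb
  set γ := R⁻¹ *ᵥ b with hγ
  have hRγ : R *ᵥ γ = b := by
    rw [hγ, mulVec_mulVec, mul_nonsing_inv R (isUnit_iff_ne_zero.mpr hR.det_pos.ne'), one_mulVec]
  have heq : P = schurBlock (P (Sum.inl ()) (Sum.inl ()) - γ ⬝ᵥ b) γ R := by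
    rw [schurBlock_eq hRt, hRγ]
    ext (i | i) (j | j)
    · simp
    · simp [hb, hPs (Sum.inl i)]
    · simp [hb]
    · simp [hRdef]
  refine ⟨_, γ, R, hR, ?_, heq⟩
  rw [heq] at hP
  exact (posDef_schurBlock_iff hR _ _).mp hP

/-- The factor `i = 1` is split off; reindexing the others lowers `n` by one, which is the recursion
produced by integrating out one row. -/
theorem wishartZ_succ (n : ℝ) (d : ℕ) :
    wishartZ n (d + 1) = Real.pi ^ ((d : ℝ) / 2) * Real.Gamma (n / 2) * wishartZ (n - 1) d := by
  have h : ∏ i ∈ Finset.Icc 1 (d + 1), Real.Gamma ((n + 1 - (i : ℝ)) / 2) =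
      Real.Gamma (n / 2) * ∏ i ∈ Finset.Icc 1 d, Real.Gamma ((n - 1 + 1 - (i : ℝ)) / 2) := by
    rw [← Finset.Ico_add_one_right_eq_Icc, ← Finset.Ico_add_one_right_eq_Icc,
      Finset.prod_Ico_eq_prod_range, Finset.prod_Ico_eq_prod_range, Nat.add_sub_cancel,
      Nat.add_sub_cancel, Finset.prod_range_succ', mul_comm]
    congr 1
    · norm_num
    · refine Finset.prod_congr rfl fun i _ => ?_
      push_cast
      ring_nf
  rw [wishartZ, wishartZ, h]
  have : (((d + 1 : ℕ) : ℝ) * (((d + 1 : ℕ) : ℝ) - 1) / 4) =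
      (d : ℝ) / 2 + (d : ℝ) * ((d : ℝ) - 1) / 4 := by
    push_cast
    ring
  rw [this, Real.rpow_add Real.pi_pos]
  ring

theorem wishartZ_pos {n : ℝ} {d : ℕ} (hn : (d : ℝ) - 1 < n) : 0 < wishartZ n d := by
  refine mul_pos (by positivity) (Finset.prod_pos fun i hi => Real.Gamma_pos_of_pos ?_)
  have : (i : ℝ) ≤ d := by exact_mod_cast (Finset.mem_Icc.mp hi).2
  linarith

/-- Integration over the first row of a symmetric matrix with lower right block `C`. -/
theorem lintegral_invWishartKernel_symGlue {d : ℕ} {n : ℝ} (hn : 0 < n) {c : SymCoord d}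
    (hC : (symMat c).PosDef) {q : ℝ} (hq : 0 < q) (γ : Fin d → ℝ) {R : Matrix (Fin d) (Fin d) ℝ}
    (hR : R.PosDef) {Q : Matrix (Fin (d + 1)) (Fin (d + 1)) ℝ}
    (hQ : Q.submatrix (unitSumFin d) (unitSumFin d) = schurBlock q γ R) :
    ∫⁻ b : Fin d → ℝ, ∫⁻ a : ℝ, ENNReal.ofReal
        (invWishartKernel ((d + 2 + n) / 2) (symMat (symGlue a b c)) Q) =
      ENNReal.ofReal ((2 * Real.pi) ^ ((d : ℝ) / 2) * R.det ^ (-(1 / 2) : ℝ) *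
        ((q / 2) ^ (-(n / 2)) * Real.Gamma (n / 2))) *
        ENNReal.ofReal (invWishartKernel ((d + n) / 2) (symMat c) R) := by
  set C := symMat c with hCdef
  have hCt : Cᵀ = C := symMat_transpose c
  have hRt : Rᵀ = R := by
    simpa [IsHermitian, conjTranspose_eq_transpose_of_trivial] using hR.isHermitian
  have hdet := hC.det_pos
  set ν : ℝ := (d + 2 + n) / 2 with hν
  set h : (Fin d → ℝ) → ℝ → ℝ := fun β s =>
    (C.det ^ (-ν) * Real.exp (-(1 / 2) * (C⁻¹ * R).trace)) *
        (s ^ (-ν) * Real.exp (-((q / 2) / s)) *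
          Real.exp (-(1 / 2) * ((β - γ) ⬝ᵥ ((s⁻¹ • R) *ᵥ (β - γ))))) with hh
  have hmeas : Measurable fun p : (Fin d → ℝ) × ℝ => ENNReal.ofReal (h p.1 p.2) := by
    simp only [hh, smul_mulVec, dotProduct_smul, smul_eq_mul]
    have : Continuous fun p : (Fin d → ℝ) × ℝ => (p.1 - γ) ⬝ᵥ (R *ᵥ (p.1 - γ)) := by fun_prop
    have := this.measurable
    fun_prop
  have hinner : ∀ b : Fin d → ℝ, ∫⁻ a : ℝ, ENNReal.ofReal
        (invWishartKernel ν (symMat (symGlue a b c)) Q) =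
      ∫⁻ s in Set.Ioi 0, ENNReal.ofReal (h (C⁻¹ *ᵥ b) s) := by
    intro b
    set β := C⁻¹ *ᵥ b with hβ
    have hCβ : C *ᵥ β = b := by
      rw [hβ, mulVec_mulVec, mul_nonsing_inv C (isUnit_iff_ne_zero.mpr hdet.ne'), one_mulVec]
    -- Translating the corner by `β · b` makes the Schur complement `s` the integration variable.
    rw [← lintegral_add_right_eq_self _ (β ⬝ᵥ b), ← lintegral_indicator measurableSet_Ioi]
    refine lintegral_congr fun s => ?_
    have hV : (symMat (symGlue (s + β ⬝ᵥ b) b c)).submatrix (unitSumFin d) (unitSumFin d) =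
        schurBlock s β C := by
      rw [symMat_symGlue, schurBlock_eq hCt, hCβ]
    rw [← invWishartKernel_submatrix (unitSumFin d), hV, hQ,
      invWishartKernel_schurBlock hC hRt]
    by_cases hs : s ∈ Set.Ioi 0 <;> simp [hs, hh]
  simp_rw [hinner]
  have hCinv : (C⁻¹).det ≠ 0 := by
    rw [det_nonsing_inv, Ring.inverse_eq_inv']
    exact inv_ne_zero hdet.ne'
  -- The substitution `b = C β` has Jacobian `|C|`; after swapping, the Gaussian in `β` is
  -- integrated first.
  rw [lintegral_comp_mulVec hCinv (f := fun β => ∫⁻ s in Set.Ioi 0, ENNReal.ofReal (h β s))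
    hmeas.lintegral_prod_right', lintegral_lintegral_swap hmeas.aemeasurable]
  have hgauss : ∀ s ∈ Set.Ioi (0 : ℝ), ∫⁻ β, ENNReal.ofReal (h β s) =
      ENNReal.ofReal ((C.det ^ (-ν) * Real.exp (-(1 / 2) * (C⁻¹ * R).trace)) *
        ((2 * Real.pi) ^ ((d : ℝ) / 2) * R.det ^ (-(1 / 2) : ℝ))) *
        ENNReal.ofReal (s ^ (-1 - n / 2) * Real.exp (-((q / 2) / s))) := by
    intro s hs
    have hs : 0 < s := hs
    have hsR : (s⁻¹ • R).PosDef := hR.smul (inv_pos.mpr hs)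
    simp only [hh, ← mul_assoc]
    simp_rw [ENNReal.ofReal_mul (p := C.det ^ (-ν) * Real.exp (-(1 / 2) * (C⁻¹ * R).trace) *
      s ^ (-ν) * Real.exp (-((q / 2) / s))) (by positivity)]
    rw [lintegral_const_mul' _ _ ENNReal.ofReal_ne_top, lintegral_gaussian hsR,
      ← ENNReal.ofReal_mul (by positivity),
      ← ENNReal.ofReal_mul (by have := hR.det_pos; positivity)]
    congr 1
    rw [det_smul, Real.mul_rpow (by positivity) hR.det_pos.le, Fintype.card_fin,
      ← Real.rpow_natCast, ← Real.rpow_mul (by positivity), Real.inv_rpow hs.le,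
      ← Real.rpow_neg hs.le]
    -- The Gaussian with precision `R / s` contributes `s^(d/2)`, leaving the inverse gamma exponent
    -- with `a = n / 2`.
    have : s ^ (-1 - n / 2) = s ^ (-ν) * s ^ (-((d : ℝ) * -(1 / 2))) := by
      rw [← Real.rpow_add hs]
      congr 1
      rw [hν]
      ring
    rw [this]
    ring
  rw [setLIntegral_congr_fun measurableSet_Ioi hgauss,
    lintegral_const_mul' _ _ ENNReal.ofReal_ne_top,
    lintegral_inverse_gamma (by positivity) (by positivity), ← ENNReal.ofReal_mul,
    ← ENNReal.ofReal_mul (abs_nonneg _), ← ENNReal.ofReal_mul]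
  rotate_left
  · have := hR.det_pos
    have := Real.Gamma_pos_of_pos (half_pos hn)
    positivity
  · have := hR.det_pos
    positivity
  congr 1
  rw [invWishartKernel, if_pos hC, det_nonsing_inv, Ring.inverse_eq_inv', inv_inv,
    abs_of_pos hdet]
  -- The Jacobian lowers the exponent of `|C|` by one, to that of dimension `d` with `n - 1` degrees
  -- of freedom.
  have : C.det ^ (-((d + n) / 2)) = C.det * C.det ^ (-ν) := by
    rw [mul_comm, ← Real.rpow_add_one hdet.ne']
    congr 1
    rw [hν]
    ring
  rw [this]
  ring

/-- Induction on the dimension with `n` generalized: removing a row replaces `(d + 1, n)` by `(d, n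
- 1)`, which preserves the condition on the degrees of freedom. -/
theorem lintegral_invWishartKernel (d : ℕ) {n : ℝ} (hn : (d : ℝ) - 1 < n)
    {Q : Matrix (Fin d) (Fin d) ℝ} (hQ : Q.PosDef) :
    ∫⁻ v : SymCoord d, ENNReal.ofReal (invWishartKernel ((d + 1 + n) / 2) (symMat v) Q) =
      ENNReal.ofReal (wishartZ n d * 2 ^ (n * d / 2) * Q.det ^ (-(n / 2))) := by
  induction d generalizing n with
  | zero =>
    -- In dimension zero there are no coordinates: the measure is a Dirac mass and the only matrix
    -- is the identity.
    rw [volume_pi, Measure.pi_of_empty, lintegral_dirac]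
    have hp : (symMat (fun p : {p : Fin 0 × Fin 0 // p.1 ≤ p.2} => isEmptyElim p)).PosDef := by
      rw [Subsingleton.elim (symMat _) (1 : Matrix (Fin 0) (Fin 0) ℝ)]
      exact PosDef.one
    rw [invWishartKernel, if_pos hp]
    simp [wishartZ, trace]
  | succ d ih =>
    have hn' : (d : ℝ) - 1 < n - 1 := by
      push_cast at hn
      linarith
    have hn0 : 0 < n := by
      have : (0 : ℝ) ≤ d := by positivity
      push_cast at hn
      linarith
    obtain ⟨q, γ, R, hR, hq, hQR⟩ :=
      exists_eq_schurBlock ((posDef_submatrix_equiv_iff (unitSumFin d)).mpr hQ)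
    have hdetQ : Q.det = q * R.det := by
      rw [← det_schurBlock q γ R, ← hQR, det_submatrix_equiv_self]
    have hRpos := hR.det_pos
    rw [lintegral_symCoord_succ (measurable_invWishartKernel _ _).ennreal_ofReal]
    have hstep : ∀ c : SymCoord d, ∫⁻ b : Fin d → ℝ, ∫⁻ a : ℝ, ENNReal.ofReal
        (invWishartKernel (((d + 1 : ℕ) + 1 + n) / 2) (symMat (symGlue a b c)) Q) =
      ENNReal.ofReal ((2 * Real.pi) ^ ((d : ℝ) / 2) * R.det ^ (-(1 / 2) : ℝ) *
        ((q / 2) ^ (-(n / 2)) * Real.Gamma (n / 2))) *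
        ENNReal.ofReal (invWishartKernel ((d + 1 + (n - 1)) / 2) (symMat c) R) := by
      intro c
      by_cases hC : (symMat c).PosDef
      · have := lintegral_invWishartKernel_symGlue hn0 hC hq γ hR hQR
        have h1 : ((d : ℝ) + 1 + (n - 1)) / 2 = (d + n) / 2 := by ring
        have h2 : (((d + 1 : ℕ) : ℝ) + 1 + n) / 2 = (d + 2 + n) / 2 := by push_cast; ring
        rw [h1, h2, this]
      -- Principal blocks of positive definite matrices are positive definite, so both sides vanish.
      · have h0 : ∀ a b, ¬ (symMat (symGlue a b c)).PosDef := fun a b h => hC <| by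
          have h1 := (h.submatrix (unitSumFin d).injective).submatrix Sum.inr_injective
          rw [symMat_symGlue] at h1
          exact h1
        simp [invWishartKernel, h0, hC]
    simp_rw [hstep]
    rw [lintegral_const_mul' _ _ ENNReal.ofReal_ne_top, ih hn' hR, ← ENNReal.ofReal_mul]
    · congr 1
      rw [wishartZ_succ, hdetQ, Real.mul_rpow hq.le hRpos.le, Real.div_rpow hq.le (by norm_num),
        Real.mul_rpow (by norm_num) Real.pi_pos.le]
      have h1 : R.det ^ (-(n / 2)) = R.det ^ (-(1 / 2) : ℝ) * R.det ^ (-((n - 1) / 2)) := by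
        rw [← Real.rpow_add hRpos]
        congr 1
        ring
      have h2 : (2 : ℝ) ^ (n * ((d + 1 : ℕ) : ℝ) / 2) =
          2 ^ ((d : ℝ) / 2) * (2 ^ (-(n / 2)))⁻¹ * 2 ^ ((n - 1) * d / 2) := by
        rw [← Real.rpow_neg (by norm_num), ← Real.rpow_add (by norm_num),
          ← Real.rpow_add (by norm_num)]
        congr 1
        push_cast
        ring
      rw [h1, h2]
      ring
    · have := Real.Gamma_pos_of_pos (half_pos hn0)
      positivity

/-! ### The normal-inverse-Wishart family -/

section NIW

set_option linter.unusedSectionVars false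

variable {d : ℕ} {ι : Type} [Fintype ι] [DecidableEq ι]

open Classical in
/-- The normal-inverse-Wishart density up to normalization. -/
def niwKernel (M : Matrix (Fin d) ι ℝ) (K : Matrix ι ι ℝ) (Q : Matrix (Fin d) (Fin d) ℝ) (ν : ℝ)
    (θ : Param d ι) : ℝ :=
  if θ.V.PosDef then θ.V.det ^ (-ν) * Real.exp (-(1 / 2) *
    (((θ.A - M)ᵀ * θ.V⁻¹ * (θ.A - M) * K).trace + (θ.V⁻¹ * Q).trace)) else 0

theorem niwKernel_of_posDef (M : Matrix (Fin d) ι ℝ) (K : Matrix ι ι ℝ)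
    (Q : Matrix (Fin d) (Fin d) ℝ) (ν : ℝ) {θ : Param d ι} (hV : θ.V.PosDef) :
    niwKernel M K Q ν θ = θ.V.det ^ (-ν) * Real.exp (-(1 / 2) *
      (((θ.A - M)ᵀ * θ.V⁻¹ * (θ.A - M) * K).trace + (θ.V⁻¹ * Q).trace)) :=
  if_pos hV

theorem niwKernel_of_not_posDef (M : Matrix (Fin d) ι ℝ) (K : Matrix ι ι ℝ)
    (Q : Matrix (Fin d) (Fin d) ℝ) (ν : ℝ) {θ : Param d ι} (hV : ¬ θ.V.PosDef) :
    niwKernel M K Q ν θ = 0 :=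
  if_neg hV

/-- The part of the normalizing constant that depends only on the degrees of freedom. -/
def niwScale (d m : ℕ) (n : ℝ) : ℝ :=
  ((2 * Real.pi) ^ ((d : ℝ) * m / 2))⁻¹ * (wishartZ n d * 2 ^ (n * d / 2))⁻¹

/-- The normalizing constant of the normal-inverse-Wishart density. -/
def niwConst (K : Matrix ι ι ℝ) (Q : Matrix (Fin d) (Fin d) ℝ) (n : ℝ) : ℝ :=
  niwScale d (Fintype.card ι) n * (K.det ^ ((d : ℝ) / 2) * Q.det ^ (n / 2))

theorem niwScale_pos (m : ℕ) {n : ℝ} (hn : (d : ℝ) - 1 < n) : 0 < niwScale d m n := by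
  have := wishartZ_pos hn
  unfold niwScale
  positivity

theorem niwConst_pos {K : Matrix ι ι ℝ} {Q : Matrix (Fin d) (Fin d) ℝ} {n : ℝ} (hK : K.PosDef)
    (hQ : Q.PosDef) (hn : (d : ℝ) - 1 < n) : 0 < niwConst K Q n := by
  have := niwScale_pos (Fintype.card ι) hn
  have := hK.det_pos
  have := hQ.det_pos
  unfold niwConst
  positivity

/-- Collects the powers of `|V|`: `m/2` from the matrix normal, `(d+1)/2` and `n/2` from the inverse
Wishart. -/
theorem priorDensity_eq {M : Matrix (Fin d) ι ℝ} {K : Matrix ι ι ℝ}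
    {Q : Matrix (Fin d) (Fin d) ℝ} (hQ : Q.PosDef) (n : ℝ) (θ : Param d ι) :
    priorDensity M K Q n θ =
      niwConst K Q n * niwKernel M K Q ((Fintype.card ι + d + 1 + n) / 2) θ := by
  unfold priorDensity invWishartDensity niwKernel
  split_ifs with hV
  · have hv := hV.det_pos
    have hq := hQ.det_pos
    have h1 : ((2 * Real.pi) • θ.V).det ^ ((Fintype.card ι : ℝ) / 2) =
        (2 * Real.pi) ^ ((d : ℝ) * Fintype.card ι / 2) * θ.V.det ^ ((Fintype.card ι : ℝ) / 2) := by
      rw [det_smul, Fintype.card_fin, Real.mul_rpow (by positivity) hv.le, ← Real.rpow_natCast,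
        ← Real.rpow_mul (by positivity)]
      congr 2
      ring
    have h2 : (((1 : ℝ) / 2) • (θ.V⁻¹ * Q)).det ^ (n / 2) =
        (2 ^ (n * d / 2))⁻¹ * (θ.V.det ^ (n / 2))⁻¹ * Q.det ^ (n / 2) := by
      rw [det_smul, det_mul, det_nonsing_inv, Ring.inverse_eq_inv', Fintype.card_fin,
        Real.mul_rpow (by positivity) (by positivity), Real.mul_rpow (by positivity) hq.le,
        Real.inv_rpow hv.le, one_div, inv_pow, Real.inv_rpow (by positivity), ← Real.rpow_natCast,
        ← Real.rpow_mul (by positivity)]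
      rw [show (d : ℝ) * (n / 2) = n * d / 2 by ring]
      ring
    have h3 : θ.V.det ^ (-(((Fintype.card ι : ℝ) + d + 1 + n) / 2)) =
        (θ.V.det ^ ((Fintype.card ι : ℝ) / 2))⁻¹ * (θ.V.det ^ (((d : ℝ) + 1) / 2))⁻¹ *
          (θ.V.det ^ (n / 2))⁻¹ := by
      rw [← Real.rpow_neg hv.le, ← Real.rpow_neg hv.le, ← Real.rpow_neg hv.le,
        ← Real.rpow_add hv, ← Real.rpow_add hv]
      congr 1
      ring
    rw [matrixNormalDensity, h1, h2, h3, mul_add, Real.exp_add, niwConst, niwScale, mul_inv]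
    ring
  · simp

theorem niwKernel_nonneg (M : Matrix (Fin d) ι ℝ) (K : Matrix ι ι ℝ)
    (Q : Matrix (Fin d) (Fin d) ℝ) (ν : ℝ) (θ : Param d ι) : 0 ≤ niwKernel M K Q ν θ := by
  unfold niwKernel
  split_ifs with hV
  · have := hV.det_pos
    positivity
  · exact le_rfl

/-- Closure of the family under positive powers, which makes the moments of the density explicit. -/
theorem niwKernel_rpow (M : Matrix (Fin d) ι ℝ) (K : Matrix ι ι ℝ)
    (Q : Matrix (Fin d) (Fin d) ℝ) (ν : ℝ) {s : ℝ} (hs : 0 < s) (θ : Param d ι) :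
    niwKernel M K Q ν θ ^ s = niwKernel M (s • K) (s • Q) (s * ν) θ := by
  unfold niwKernel
  split_ifs with hV
  · have := hV.det_pos
    rw [Real.mul_rpow (by positivity) (by positivity), ← Real.rpow_mul this.le, ← Real.exp_mul,
      Matrix.mul_smul, Matrix.mul_smul, trace_smul, trace_smul, smul_eq_mul, smul_eq_mul]
    congr 2 <;> ring
  · exact Real.zero_rpow hs.ne'

theorem continuous_paramV : Continuous (Param.V : Param d ι → Matrix (Fin d) (Fin d) ℝ) :=
  continuous_symMat.comp continuous_snd

theorem continuous_paramA : Continuous (Param.A : Param d ι → Matrix (Fin d) ι ℝ) :=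
  continuous_fst

theorem measurable_det_paramV : Measurable fun θ : Param d ι => θ.V.det :=
  measurable_det_symMat.comp measurable_snd

theorem measurableSet_posDef_paramV : MeasurableSet {θ : Param d ι | θ.V.PosDef} :=
  measurable_snd measurableSet_posDef_symMat

theorem measurable_niwKernel (M : Matrix (Fin d) ι ℝ) (K : Matrix ι ι ℝ)
    (Q : Matrix (Fin d) (Fin d) ℝ) (ν : ℝ) : Measurable (niwKernel M K Q ν) := by
  unfold niwKernel
  have h := fun θ : Param d ι => trace_mul_inv_mul 1 θ.V Q
  have h' := fun θ : Param d ι => trace_mul_inv_mul (θ.A - M)ᵀ θ.V ((θ.A - M) * K)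
  simp only [Matrix.one_mul] at h
  simp only [← Matrix.mul_assoc] at h'
  simp_rw [h, h']
  have hV := continuous_paramV (d := d) (ι := ι)
  have hA := continuous_paramA (d := d) (ι := ι)
  have h1 : Continuous fun θ : Param d ι => (θ.V.adjugate * Q).trace := by fun_prop
  have h1' : Continuous fun θ : Param d ι =>
    ((θ.A - M)ᵀ * θ.V.adjugate * (θ.A - M) * K).trace := by fun_prop
  have h2 := measurable_det_paramV (d := d) (ι := ι)
  refine Measurable.ite measurableSet_posDef_paramV ?_ measurable_const
  exact (h2.pow_const _).mul
    (((h2.inv.mul h1'.measurable).add (h2.inv.mul h1.measurable)).const_mul _).exp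

/-- Integrating over `A` first yields `|V|^(m/2)`, which turns the rest into the inverse Wishart
kernel. -/
theorem lintegral_niwKernel (M : Matrix (Fin d) ι ℝ) {K : Matrix ι ι ℝ}
    {Q : Matrix (Fin d) (Fin d) ℝ} (hK : K.PosDef) (hQ : Q.PosDef) {n : ℝ}
    (hn : (d : ℝ) - 1 < n) :
    ∫⁻ θ, ENNReal.ofReal (niwKernel M K Q ((Fintype.card ι + d + 1 + n) / 2) θ) =
      ENNReal.ofReal (niwConst K Q n)⁻¹ := by
  have hk := hK.det_pos
  have hq := hQ.det_pos
  change ∫⁻ θ, _ ∂(volume.prod volume) = _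
  rw [lintegral_prod_symm _ (measurable_niwKernel M K Q _).ennreal_ofReal.aemeasurable]
  have hinner : ∀ v : SymCoord d, ∫⁻ A : Fin d → ι → ℝ,
      ENNReal.ofReal (niwKernel M K Q ((Fintype.card ι + d + 1 + n) / 2) (A, v)) =
        ENNReal.ofReal ((2 * Real.pi) ^ ((d : ℝ) * Fintype.card ι / 2) * K.det ^ (-(d : ℝ) / 2)) *
          ENNReal.ofReal (invWishartKernel ((d + 1 + n) / 2) (symMat v) Q) := by
    intro v
    by_cases hV : (symMat v).PosDef
    · have hv := hV.det_pos
      have hcongr : ∀ A : Fin d → ι → ℝ, ENNReal.ofReal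
          (niwKernel M K Q ((Fintype.card ι + d + 1 + n) / 2) (A, v)) =
          ENNReal.ofReal ((symMat v).det ^ (-((Fintype.card ι + d + 1 + n) / 2)) *
            Real.exp (-(1 / 2) * ((symMat v)⁻¹ * Q).trace)) *
          ENNReal.ofReal (Real.exp (-(1 / 2) *
            ((Matrix.of A - M)ᵀ * (symMat v)⁻¹ * (Matrix.of A - M) * K).trace)) := by
        intro A
        rw [niwKernel_of_posDef M K Q _ (θ := (A, v)) hV, ← ENNReal.ofReal_mul (by positivity), mul_add,
          Real.exp_add, mul_comm (Real.exp _), ← mul_assoc]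
        rfl
      simp_rw [hcongr]
      rw [lintegral_const_mul' _ _ ENNReal.ofReal_ne_top, lintegral_matrix_gaussian hV.inv hK M,
        ← ENNReal.ofReal_mul (by positivity), ← ENNReal.ofReal_mul (by positivity)]
      congr 1
      have h1 : (symMat v).det ^ (-((d + 1 + n) / 2)) =
          (symMat v).det ^ (-((Fintype.card ι + d + 1 + n) / 2)) *
            ((symMat v)⁻¹).det ^ (-(Fintype.card ι : ℝ) / 2) := by
        rw [det_nonsing_inv, Ring.inverse_eq_inv', Real.inv_rpow hv.le, ← Real.rpow_neg hv.le,
          ← Real.rpow_add hv]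
        congr 1
        ring
      rw [invWishartKernel, if_pos hV, h1, Fintype.card_fin]
      ring
    · have h0 : ∀ A : Fin d → ι → ℝ,
          niwKernel M K Q ((Fintype.card ι + d + 1 + n) / 2) (A, v) = 0 :=
        fun A => niwKernel_of_not_posDef M K Q _ (θ := (A, v)) hV
      simp [h0, invWishartKernel, hV]
  simp_rw [hinner]
  rw [lintegral_const_mul' _ _ ENNReal.ofReal_ne_top, lintegral_invWishartKernel d hn hQ,
    ← ENNReal.ofReal_mul (by positivity)]
  congr 1
  rw [niwConst, niwScale, neg_div, Real.rpow_neg hk.le, Real.rpow_neg hq.le]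
  simp only [mul_inv, inv_inv]
  ring

theorem integrable_niwKernel (M : Matrix (Fin d) ι ℝ) {K : Matrix ι ι ℝ}
    {Q : Matrix (Fin d) (Fin d) ℝ} (hK : K.PosDef) (hQ : Q.PosDef) {n : ℝ}
    (hn : (d : ℝ) - 1 < n) :
    Integrable (niwKernel M K Q ((Fintype.card ι + d + 1 + n) / 2)) := by
  refine ⟨(measurable_niwKernel M K Q _).aestronglyMeasurable, ?_⟩
  rw [hasFiniteIntegral_iff_ofReal (ae_of_all _ fun _ => niwKernel_nonneg M K Q _ _),
    lintegral_niwKernel M hK hQ hn]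
  exact ENNReal.ofReal_lt_top

theorem integral_niwKernel (M : Matrix (Fin d) ι ℝ) {K : Matrix ι ι ℝ}
    {Q : Matrix (Fin d) (Fin d) ℝ} (hK : K.PosDef) (hQ : Q.PosDef) {n : ℝ}
    (hn : (d : ℝ) - 1 < n) :
    ∫ θ, niwKernel M K Q ((Fintype.card ι + d + 1 + n) / 2) θ = (niwConst K Q n)⁻¹ := by
  rw [integral_eq_lintegral_of_nonneg_ae (ae_of_all _ fun _ => niwKernel_nonneg M K Q _ _)
    (measurable_niwKernel M K Q _).aestronglyMeasurable, lintegral_niwKernel M hK hQ hn,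
    ENNReal.toReal_ofReal (inv_nonneg.mpr (niwConst_pos hK hQ hn).le)]

variable {K : Matrix ι ι ℝ} {Q : Matrix (Fin d) (Fin d) ℝ} {n : ℝ}

theorem measurable_priorDensity (M : Matrix (Fin d) ι ℝ) (K : Matrix ι ι ℝ) (hQ : Q.PosDef)
    (n : ℝ) : Measurable (priorDensity M K Q n) := by
  have : priorDensity M K Q n = fun θ => niwConst K Q n *
      niwKernel M K Q ((Fintype.card ι + d + 1 + n) / 2) θ := funext (priorDensity_eq hQ n)
  rw [this]
  exact (measurable_niwKernel M K Q _).const_mul _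

theorem priorDensity_nonneg (M : Matrix (Fin d) ι ℝ) (hK : K.PosDef) (hQ : Q.PosDef)
    (hn : (d : ℝ) - 1 < n) (θ : Param d ι) : 0 ≤ priorDensity M K Q n θ := by
  rw [priorDensity_eq hQ]
  exact mul_nonneg (niwConst_pos hK hQ hn).le (niwKernel_nonneg _ _ _ _ _)

theorem integrable_priorDensity (M : Matrix (Fin d) ι ℝ) (hK : K.PosDef) (hQ : Q.PosDef)
    (hn : (d : ℝ) - 1 < n) : Integrable (priorDensity M K Q n) := by
  have : priorDensity M K Q n = fun θ => niwConst K Q n *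
      niwKernel M K Q ((Fintype.card ι + d + 1 + n) / 2) θ := funext (priorDensity_eq hQ n)
  rw [this]
  exact (integrable_niwKernel M hK hQ hn).const_mul _

theorem integral_priorDensity (M : Matrix (Fin d) ι ℝ) (hK : K.PosDef) (hQ : Q.PosDef)
    (hn : (d : ℝ) - 1 < n) : ∫ θ, priorDensity M K Q n θ = 1 := by
  simp_rw [priorDensity_eq hQ]
  rw [integral_const_mul, integral_niwKernel M hK hQ hn,
    mul_inv_cancel₀ (niwConst_pos hK hQ hn).ne']

theorem lintegral_priorDensity (M : Matrix (Fin d) ι ℝ) (hK : K.PosDef) (hQ : Q.PosDef)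
    (hn : (d : ℝ) - 1 < n) : ∫⁻ θ, ENNReal.ofReal (priorDensity M K Q n θ) = 1 := by
  rw [← ofReal_integral_eq_lintegral_ofReal (integrable_priorDensity M hK hQ hn)
    (ae_of_all _ (priorDensity_nonneg M hK hQ hn)), integral_priorDensity M hK hQ hn,
    ENNReal.ofReal_one]

/-! ### Powers of the density and finiteness of the entropy -/

/-- The integral of the `s`-th power of a normal-inverse-Wishart density, up to the powers of
`|K|` and `|Q|` it contains. -/
def niwPowConst (d m : ℕ) (n s : ℝ) : ℝ :=
  niwScale d m n ^ s / niwScale d m (s * (m + d + 1 + n) - (m + d + 1)) *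
    s ^ (-((m : ℝ) * d / 2)) * s ^ (-(d * ((s * (m + d + 1 + n) - (m + d + 1)) / 2)))

theorem niwConst_smul {s : ℝ} (hs : 0 < s) (hK : K.PosDef) (hQ : Q.PosDef) (n : ℝ) :
    niwConst (s • K) (s • Q) n =
      niwConst K Q n * (s ^ ((Fintype.card ι : ℝ) * d / 2) * s ^ (d * (n / 2))) := by
  have hk := hK.det_pos
  have hq := hQ.det_pos
  rw [niwConst, niwConst, det_smul, det_smul, Real.mul_rpow (by positivity) hk.le,
    Real.mul_rpow (by positivity) hq.le, ← Real.rpow_natCast, ← Real.rpow_natCast,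
    ← Real.rpow_mul hs.le, ← Real.rpow_mul hs.le, Fintype.card_fin, mul_div_assoc]
  ring

/-- The power is a kernel with `s(m+d+1+n) - (m+d+1)` degrees of freedom, and `hsn` says that this
is admissible. The dependence on `|K|` and `|Q|` is kept explicit because `Q` will later vary with
`y`. -/
theorem integrable_and_integral_priorDensity_rpow (M : Matrix (Fin d) ι ℝ) (hK : K.PosDef)
    (hQ : Q.PosDef) (hn : (d : ℝ) - 1 < n) {s : ℝ} (hs : 0 < s)
    (hsn : (d : ℝ) - 1 < s * (Fintype.card ι + d + 1 + n) - (Fintype.card ι + d + 1)) :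
    Integrable (fun θ => priorDensity M K Q n θ ^ s) ∧
    ∫ θ, priorDensity M K Q n θ ^ s = niwPowConst d (Fintype.card ι) n s *
      (K.det ^ ((s - 1) * (d / 2)) * Q.det ^ ((1 - s) * ((Fintype.card ι + d + 1) / 2))) := by
  have hk := hK.det_pos
  have hq := hQ.det_pos
  have hsc := niwScale_pos (Fintype.card ι) hn
  have hfun : (fun θ => priorDensity M K Q n θ ^ s) = fun θ => niwConst K Q n ^ s *
      niwKernel M (s • K) (s • Q) ((Fintype.card ι + d + 1 +
        (s * (Fintype.card ι + d + 1 + n) - (Fintype.card ι + d + 1))) / 2) θ := by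
    ext θ
    rw [priorDensity_eq hQ, Real.mul_rpow (niwConst_pos hK hQ hn).le (niwKernel_nonneg _ _ _ _ _),
      niwKernel_rpow _ _ _ _ hs]
    congr 2
    ring
  have hsK := hK.smul hs
  have hsQ := hQ.smul hs
  rw [hfun]
  refine ⟨(integrable_niwKernel M hsK hsQ hsn).const_mul _, ?_⟩
  rw [integral_const_mul, integral_niwKernel M hsK hsQ hsn, niwConst_smul hs hK hQ]
  set n' := s * (Fintype.card ι + d + 1 + n) - (Fintype.card ι + d + 1) with hn'
  rw [niwConst, niwConst, niwPowConst, ← hn', Real.mul_rpow hsc.le (by positivity),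
    Real.mul_rpow (by positivity) (by positivity), ← Real.rpow_mul hk.le, ← Real.rpow_mul hq.le]
  have h1 : K.det ^ ((s - 1) * ((d : ℝ) / 2)) =
      K.det ^ ((d : ℝ) / 2 * s) * (K.det ^ ((d : ℝ) / 2))⁻¹ := by
    rw [← Real.rpow_neg hk.le, ← Real.rpow_add hk]
    congr 1
    ring
  have h2 : Q.det ^ ((1 - s) * (((Fintype.card ι : ℝ) + d + 1) / 2)) =
      Q.det ^ (n / 2 * s) * (Q.det ^ (n' / 2))⁻¹ := by
    rw [← Real.rpow_neg hq.le, ← Real.rpow_add hq]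
    congr 1
    rw [hn']
    ring
  rw [h1, h2, Real.rpow_neg hs.le, Real.rpow_neg hs.le]
  simp only [mul_inv, div_eq_mul_inv]
  ring

/-- Apply `log t ≤ t^δ / δ` to `p` and to `p⁻¹`. -/
theorem abs_mul_log_le {p δ : ℝ} (hp : 0 ≤ p) (hδ : 0 < δ) :
    |p * Real.log p| ≤ δ⁻¹ * (p ^ (1 + δ) + p ^ (1 - δ)) := by
  rcases hp.eq_or_lt with rfl | hp
  · simp only [zero_mul, abs_zero]
    positivity
  · have h1 := Real.log_le_rpow_div hp.le hδ
    have h2 := Real.log_le_rpow_div (inv_pos.mpr hp).le hδ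
    rw [Real.log_inv, Real.inv_rpow hp.le, ← Real.rpow_neg hp.le] at h2
    have h3 : 0 < p ^ δ / δ := by positivity
    have h4 : 0 < p ^ (-δ) / δ := by positivity
    have h5 : |Real.log p| ≤ p ^ δ / δ + p ^ (-δ) / δ := abs_le.mpr ⟨by linarith, by linarith⟩
    rw [abs_mul, abs_of_pos hp, sub_eq_add_neg, Real.rpow_add hp, Real.rpow_add hp, Real.rpow_one]
    calc p * |Real.log p| ≤ p * (p ^ δ / δ + p ^ (-δ) / δ) := by gcongr
      _ = _ := by ring

/-- Only the power `1 - δ` can lose integrability; `hδn` keeps its degrees of freedom above `d - 1`.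
-/
theorem integrable_and_integral_abs_priorDensity_mul_log_le (M : Matrix (Fin d) ι ℝ)
    (hK : K.PosDef) (hQ : Q.PosDef) (hn : (d : ℝ) - 1 < n) {δ : ℝ} (hδ : 0 < δ) (hδ' : δ < 1)
    (hδn : δ * (Fintype.card ι + d + 1 + n) < n - (d - 1)) :
    Integrable (fun θ => priorDensity M K Q n θ * Real.log (priorDensity M K Q n θ)) ∧
    ∫ θ, |priorDensity M K Q n θ * Real.log (priorDensity M K Q n θ)| ≤
      δ⁻¹ * (niwPowConst d (Fintype.card ι) n (1 + δ) * (K.det ^ (δ * (d / 2)) *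
          Q.det ^ (-δ * ((Fintype.card ι + d + 1) / 2))) +
        niwPowConst d (Fintype.card ι) n (1 - δ) * (K.det ^ (-δ * (d / 2)) *
          Q.det ^ (δ * ((Fintype.card ι + d + 1) / 2)))) := by
  have hN : 0 < (Fintype.card ι : ℝ) + d + 1 + n := by
    have : (0 : ℝ) ≤ d := by positivity
    have : (0 : ℝ) ≤ Fintype.card ι := by positivity
    linarith
  obtain ⟨i1, e1⟩ := integrable_and_integral_priorDensity_rpow M hK hQ hn (s := 1 + δ)
    (by linarith) (by nlinarith)
  obtain ⟨i2, e2⟩ := integrable_and_integral_priorDensity_rpow M hK hQ hn (s := 1 - δ)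
    (by linarith) (by nlinarith)
  have hm := measurable_priorDensity M K hQ n
  have hb := fun θ => abs_mul_log_le (priorDensity_nonneg M hK hQ hn θ) hδ
  have hi := (i1.add i2).const_mul δ⁻¹
  have hint : Integrable (fun θ => priorDensity M K Q n θ * Real.log (priorDensity M K Q n θ)) :=
    hi.mono' (hm.mul hm.log).aestronglyMeasurable (ae_of_all _ hb)
  refine ⟨hint, (integral_mono hint.abs hi hb).trans_eq ?_⟩
  simp only [Pi.add_apply]
  rw [integral_const_mul, integral_add i1 i2, e1, e2]
  ring_nf

theorem integrable_priorDensity_mul_log (M : Matrix (Fin d) ι ℝ)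
    (hK : K.PosDef) (hQ : Q.PosDef) (hn : (d : ℝ) - 1 < n) :
    Integrable (fun θ => priorDensity M K Q n θ * Real.log (priorDensity M K Q n θ)) := by
  have h0 : (0 : ℝ) ≤ d := by positivity
  have h1 : (0 : ℝ) ≤ Fintype.card ι := by positivity
  have hN : 0 < (Fintype.card ι : ℝ) + d + 1 + n := by linarith
  -- Half of the largest exponent allowed by the moment condition.
  have hδ : 0 < (n - (d - 1)) / (2 * (Fintype.card ι + d + 1 + n)) :=
    div_pos (by linarith) (by linarith)
  refine (integrable_and_integral_abs_priorDensity_mul_log_le M hK hQ hn hδ ?_ ?_).1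
  · rw [div_lt_one (by linarith)]
    linarith
  · rw [div_mul_eq_mul_div, div_lt_iff₀ (by linarith)]
    nlinarith

/-! ### Dependence of the entropy on `M` and `K` -/

theorem map_param_affine {B : Matrix ι ι ℝ} (hB : B.det ≠ 0) (M : Fin d → ι → ℝ) :
    Measure.map (fun θ : Param d ι => ((fun i => (θ.1 i - M i) ᵥ* B, θ.2) : Param d ι)) volume =
      ENNReal.ofReal ((|B.det| ^ d)⁻¹) • volume := by
  have h1 : Measurable fun A : Fin d → ι → ℝ => fun i => (A i - M i) ᵥ* B := by
    refine Continuous.measurable ?_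
    fun_prop
  have h2 : Measure.map (fun A : Fin d → ι → ℝ => fun i => (A i - M i) ᵥ* B) volume =
      ENNReal.ofReal ((|B.det| ^ d)⁻¹) • volume := by
    have h3 := map_mul_right_volume (α := Fin d) hB
    have h4 := map_sub_right_eq_self (volume : Measure (Fin d → ι → ℝ)) M
    rw [Fintype.card_fin] at h3
    conv_rhs => rw [← h3, ← h4]
    rw [Measure.map_map (g := fun A : Fin d → ι → ℝ => fun i => A i ᵥ* B)
      (Continuous.measurable (by fun_prop)) (measurable_sub_const _)]
    rfl
  have h5 := Measure.map_prod_map (volume : Measure (Fin d → ι → ℝ))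
    (volume : Measure (SymCoord d)) h1 measurable_id
  rw [h2, Measure.map_id, Measure.prod_smul_left] at h5
  exact h5.symm

theorem priorDensity_eq_standard (M : Matrix (Fin d) ι ℝ) (hQ : Q.PosDef) (n : ℝ)
    {B : Matrix ι ι ℝ} (hKB : K = Bᵀ * B) (θ : Param d ι) :
    priorDensity M K Q n θ = K.det ^ ((d : ℝ) / 2) *
      priorDensity 0 1 Q n ((fun i => (θ.1 i - M i) ᵥ* Bᵀ, θ.2) : Param d ι) := by
  rw [priorDensity_eq hQ, priorDensity_eq hQ, niwConst, niwConst, det_one, Real.one_rpow, one_mul]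
  have hA : Param.A ((fun i => (θ.1 i - M i) ᵥ* Bᵀ, θ.2) : Param d ι) = (θ.A - M) * Bᵀ := by
    ext i j
    simp [Param.A, Matrix.mul_apply, vecMul, dotProduct]
  have : niwKernel M K Q ((Fintype.card ι + d + 1 + n) / 2) θ =
      niwKernel 0 1 Q ((Fintype.card ι + d + 1 + n) / 2)
        ((fun i => (θ.1 i - M i) ᵥ* Bᵀ, θ.2) : Param d ι) := by
    by_cases hV : θ.V.PosDef
    · have ht : ((θ.A - M)ᵀ * θ.V⁻¹ * (θ.A - M) * K).trace =
          (((θ.A - M) * Bᵀ)ᵀ * θ.V⁻¹ * ((θ.A - M) * Bᵀ)).trace := by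
        rw [hKB, ← Matrix.mul_assoc, trace_mul_comm, transpose_mul, transpose_transpose]
        simp only [Matrix.mul_assoc]
      rw [niwKernel_of_posDef _ _ _ _ hV, ht, niwKernel_of_posDef _ _ _ _
        (θ := ((fun i => (θ.1 i - M i) ᵥ* Bᵀ, θ.2) : Param d ι)) hV, hA, sub_zero, Matrix.mul_one]
      rfl
    · rw [niwKernel_of_not_posDef _ _ _ _ hV, niwKernel_of_not_posDef _ _ _ _
        (θ := ((fun i => (θ.1 i - M i) ᵥ* Bᵀ, θ.2) : Param d ι)) hV]
  rw [this]
  ring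

/-- After standardizing, the factor `|K|^(d/2)` outside the logarithm cancels the Jacobian; the one
inside contributes `(d/2) log |K|` times the total mass `1`. -/
theorem entropy_priorDensity (M : Matrix (Fin d) ι ℝ) (hK : K.PosDef) (hQ : Q.PosDef)
    (hn : (d : ℝ) - 1 < n) :
    entropy (priorDensity M K Q n) = -((d : ℝ) / 2) * Real.log K.det +
      entropy (priorDensity (0 : Matrix (Fin d) ι ℝ) 1 Q n) := by
  obtain ⟨B, hKB, hB⟩ := exists_transpose_mul_self_of_posDef hK
  have hk := hK.det_pos
  have hB' : Bᵀ.det ≠ 0 := by rwa [det_transpose]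
  set T : Param d ι → Param d ι := fun θ => (fun i => (θ.1 i - M i) ᵥ* Bᵀ, θ.2) with hT
  have hTm : Measurable T := by
    refine Continuous.measurable ?_
    fun_prop
  have hscale : (|Bᵀ.det| ^ d)⁻¹ = (K.det ^ ((d : ℝ) / 2))⁻¹ := by
    rw [hKB, det_mul, det_transpose, ← sq, ← sq_abs, ← Real.rpow_natCast _ 2,
      ← Real.rpow_mul (abs_nonneg _), ← Real.rpow_natCast]
    congr 2
    push_cast
    ring
  set p₀ := priorDensity (0 : Matrix (Fin d) ι ℝ) 1 Q n with hp₀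
  have hp₀m : Measurable p₀ := measurable_priorDensity _ _ hQ n
  have hone : (1 : Matrix ι ι ℝ).PosDef := PosDef.one
  have hi1 := integrable_priorDensity (0 : Matrix (Fin d) ι ℝ) hone hQ hn
  have hi2 := integrable_priorDensity_mul_log (0 : Matrix (Fin d) ι ℝ) hone hQ hn
  have hpt : ∀ θ, priorDensity M K Q n θ * Real.log (priorDensity M K Q n θ) =
      K.det ^ ((d : ℝ) / 2) * ((d : ℝ) / 2 * Real.log K.det * p₀ (T θ) +
        p₀ (T θ) * Real.log (p₀ (T θ))) := by
    intro θ
    rw [priorDensity_eq_standard M hQ n hKB θ]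
    change K.det ^ ((d : ℝ) / 2) * p₀ (T θ) * Real.log (K.det ^ ((d : ℝ) / 2) * p₀ (T θ)) = _
    by_cases h0 : p₀ (T θ) = 0
    · simp [h0]
    · rw [Real.log_mul (by positivity) h0, Real.log_rpow hk]
      ring
  have hmap := integral_map (μ := volume) hTm.aemeasurable
    (f := fun θ => (d : ℝ) / 2 * Real.log K.det * p₀ θ + p₀ θ * Real.log (p₀ θ))
    ((hp₀m.const_mul _).add (hp₀m.mul hp₀m.log)).aestronglyMeasurable
  rw [hT, map_param_affine hB' M, ← hT, integral_smul_measure, hscale,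
    ENNReal.toReal_ofReal (by positivity)] at hmap
  rw [entropy, entropy]
  simp_rw [hpt]
  rw [integral_const_mul, ← hmap, smul_eq_mul, ← mul_assoc, mul_inv_cancel₀ (by positivity),
    one_mul, integral_add (hi1.const_mul _) hi2, integral_const_mul,
    integral_priorDensity _ hone hQ hn]
  ring

end NIW

/-! ### Bayes' rule -/

/-- The matrix determinant lemma. It evaluates the coefficient left by completing the square and
later compares the objectives. -/
theorem det_add_vecMulVec {κ : Type*} [Fintype κ] [DecidableEq κ] {A : Matrix κ κ ℝ}
    (hA : A.det ≠ 0) (u v : κ → ℝ) :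
    (A + vecMulVec u v).det = A.det * (1 + v ⬝ᵥ (A⁻¹ *ᵥ u)) := by
  rw [vecMulVec_eq Unit, det_add_replicateCol_mul_replicateRow (isUnit_iff_ne_zero.mpr hA),
    ← replicateRow_vecMul, dotProduct_mulVec]
  congr 1
  rw [det_unique]
  simp [Matrix.mul_apply, dotProduct]

theorem posDef_vecMulVec_add {κ : Type*} [Fintype κ] {K : Matrix κ κ ℝ}
    (hK : K.PosDef) (x : κ → ℝ) : (vecMulVec x x + K).PosDef := by
  have h := posSemidef_vecMulVec_self_star x
  rw [star_trivial] at h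
  exact PosDef.posSemidef_add h hK

theorem posDef_add_vecMulVec {κ : Type*} [Fintype κ] {K : Matrix κ κ ℝ}
    (hK : K.PosDef) (x : κ → ℝ) : (K + vecMulVec x x).PosDef := by
  rw [add_comm]
  exact posDef_vecMulVec_add hK x

section Bayes

set_option linter.unusedSectionVars false

variable {d : ℕ} {ι : Type} [Fintype ι] [DecidableEq ι]

/-- The ratio `|K| / |x xᵀ + K|`. -/
def shrinkage (K : Matrix ι ι ℝ) (x : ι → ℝ) : ℝ := K.det / (vecMulVec x x + K).det

theorem shrinkage_pos {K : Matrix ι ι ℝ} (hK : K.PosDef) (x : ι → ℝ) : 0 < shrinkage K x :=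
  div_pos hK.det_pos (posDef_vecMulVec_add hK x).det_pos

/-- The determinant lemma applied to `K = K' - x xᵀ`, with `K' = x xᵀ + K`. -/
theorem one_sub_shrinkage {K : Matrix ι ι ℝ} (hK : K.PosDef) (x : ι → ℝ) :
    x ⬝ᵥ ((vecMulVec x x + K)⁻¹ *ᵥ x) = 1 - shrinkage K x := by
  have h := (posDef_vecMulVec_add hK x).det_pos.ne'
  have h1 := det_add_vecMulVec h (-x) x
  have h2 : vecMulVec x x + K + vecMulVec (-x) x = K := by
    rw [neg_vecMulVec]
    abel
  rw [h2, mulVec_neg, dotProduct_neg] at h1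
  rw [shrinkage, h1, mul_div_cancel_left₀ _ h]
  ring

/-- With `K' k = x` the cross terms agree, and `z zᵀ` is left with coefficient `1 - xᵀ k = |K| /
|K'|`. As an identity of matrices, before pairing with `V⁻¹`, it does not involve `V`. -/
theorem completing_square {K : Matrix ι ι ℝ} (hK : K.PosDef) (x : ι → ℝ) (D : Matrix (Fin d) ι ℝ)
    (z : Fin d → ℝ) :
    vecMulVec (z - D *ᵥ x) (z - D *ᵥ x) + D * K * Dᵀ =
      (D - vecMulVec z ((vecMulVec x x + K)⁻¹ *ᵥ x)) * (vecMulVec x x + K) *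
        (D - vecMulVec z ((vecMulVec x x + K)⁻¹ *ᵥ x))ᵀ + shrinkage K x • vecMulVec z z := by
  have hK' := posDef_vecMulVec_add hK x
  have hs := one_sub_shrinkage hK x
  set K' := vecMulVec x x + K with hK'def
  set k := K'⁻¹ *ᵥ x with hk
  have hK't : K'ᵀ = K' := by
    simpa [IsHermitian, conjTranspose_eq_transpose_of_trivial] using hK'.isHermitian
  have h1 : K' *ᵥ k = x := by
    rw [hk, mulVec_mulVec, mul_nonsing_inv K' (isUnit_iff_ne_zero.mpr hK'.det_pos.ne'), one_mulVec]
  have h2 : k ᵥ* K' = x := by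
    rw [← mulVec_transpose, hK't, h1]
  have h3 : D * K' * Dᵀ = vecMulVec (D *ᵥ x) (D *ᵥ x) + D * K * Dᵀ := by
    rw [hK'def, Matrix.mul_add, Matrix.add_mul, mul_vecMulVec, vecMulVec_mul, vecMul_transpose]
  have h4 : (D - vecMulVec z k) * K' * (D - vecMulVec z k)ᵀ =
      D * K' * Dᵀ - vecMulVec (D *ᵥ x) z - (vecMulVec z (D *ᵥ x) - (x ⬝ᵥ k) • vecMulVec z z) := by
    rw [transpose_sub, transpose_vecMulVec, Matrix.sub_mul, vecMulVec_mul, h2, Matrix.sub_mul,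
      Matrix.mul_sub, Matrix.mul_sub, mul_vecMulVec, ← mulVec_mulVec, h1, vecMulVec_mul,
      vecMul_transpose, vecMulVec_mul_vecMulVec]
    congr 2
    ext i j
    simp only [vecMulVec_apply, Matrix.smul_apply, Pi.smul_apply, smul_eq_mul]
    ring
  rw [h4, h3, hs]
  ext i j
  simp only [Matrix.add_apply, Matrix.sub_apply, vecMulVec_apply, Matrix.smul_apply, Pi.sub_apply,
    smul_eq_mul]
  ring

theorem dotProduct_mulVec_eq_trace (P : Matrix (Fin d) (Fin d) ℝ) (w : Fin d → ℝ) :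
    w ⬝ᵥ (P *ᵥ w) = (P * vecMulVec w w).trace := by
  rw [mul_vecMulVec, trace_vecMulVec, dotProduct_comm]

/-- The posterior mean of `A`. -/
def updatedMean (M : Matrix (Fin d) ι ℝ) (K : Matrix ι ι ℝ) (x : ι → ℝ) (y : Fin d → ℝ) :
    Matrix (Fin d) ι ℝ :=
  M + vecMulVec (y - M *ᵥ x) ((vecMulVec x x + K)⁻¹ *ᵥ x)

/-- The prediction error, scaled so that its distribution does not depend on `M`, `K`, `x`. -/
def residual (M : Matrix (Fin d) ι ℝ) (K : Matrix ι ι ℝ) (x : ι → ℝ) (y : Fin d → ℝ) :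
    Fin d → ℝ :=
  Real.sqrt (shrinkage K x) • (y - M *ᵥ x)

theorem vecMulVec_residual (M : Matrix (Fin d) ι ℝ) {K : Matrix ι ι ℝ} (hK : K.PosDef) (x : ι → ℝ)
    (y : Fin d → ℝ) : vecMulVec (residual M K x y) (residual M K x y) =
      shrinkage K x • vecMulVec (y - M *ᵥ x) (y - M *ᵥ x) := by
  rw [residual, smul_vecMulVec, vecMulVec_smul, smul_smul,
    Real.mul_self_sqrt (shrinkage_pos hK x).le]

/-- The conjugate update: the exponents combine by the completed square, and the normal factor
supplies the extra `|V|^(-1/2)`. -/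
theorem normalDensity_mul_niwKernel (M : Matrix (Fin d) ι ℝ) {K : Matrix ι ι ℝ} (hK : K.PosDef)
    (Q : Matrix (Fin d) (Fin d) ℝ) (ν : ℝ) (x : ι → ℝ) (y : Fin d → ℝ) (θ : Param d ι) :
    normalDensity y (θ.A *ᵥ x) θ.V * niwKernel M K Q ν θ =
      ((2 * Real.pi) ^ ((d : ℝ) / 2))⁻¹ * niwKernel (updatedMean M K x y) (vecMulVec x x + K)
        (Q + vecMulVec (residual M K x y) (residual M K x y)) (ν + 1 / 2) θ := by
  by_cases hV : θ.V.PosDef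
  · have hv := hV.det_pos
    have h1 : ((2 * Real.pi) • θ.V).det ^ ((1 : ℝ) / 2) =
        (2 * Real.pi) ^ ((d : ℝ) / 2) * θ.V.det ^ ((1 : ℝ) / 2) := by
      rw [det_smul, Fintype.card_fin, Real.mul_rpow (by positivity) hv.le, ← Real.rpow_natCast,
        ← Real.rpow_mul (by positivity)]
      congr 2
      ring
    have h2 : θ.V.det ^ (-(ν + 1 / 2)) = θ.V.det ^ (-ν) * (θ.V.det ^ ((1 : ℝ) / 2))⁻¹ := by
      rw [← Real.rpow_neg hv.le, ← Real.rpow_add hv]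
      congr 1
      ring
    have h3 : (y - θ.A *ᵥ x) ⬝ᵥ (θ.V⁻¹ *ᵥ (y - θ.A *ᵥ x)) +
        (((θ.A - M)ᵀ * θ.V⁻¹ * (θ.A - M) * K).trace + (θ.V⁻¹ * Q).trace) =
        ((θ.A - updatedMean M K x y)ᵀ * θ.V⁻¹ * (θ.A - updatedMean M K x y) *
          (vecMulVec x x + K)).trace +
        (θ.V⁻¹ * (Q + vecMulVec (residual M K x y) (residual M K x y))).trace := by
      have hcyc : ∀ (D : Matrix (Fin d) ι ℝ) (L : Matrix ι ι ℝ),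
          (Dᵀ * θ.V⁻¹ * D * L).trace = (θ.V⁻¹ * (D * L * Dᵀ)).trace := by
        intro D L
        rw [Matrix.mul_assoc, Matrix.mul_assoc, trace_mul_comm, Matrix.mul_assoc]
      have hy : y - θ.A *ᵥ x = (y - M *ᵥ x) - (θ.A - M) *ᵥ x := by
        rw [sub_mulVec]
        abel
      have hA : θ.A - updatedMean M K x y =
          (θ.A - M) - vecMulVec (y - M *ᵥ x) ((vecMulVec x x + K)⁻¹ *ᵥ x) := by
        rw [updatedMean]
        abel
      rw [dotProduct_mulVec_eq_trace, hcyc, hcyc, hy, hA, vecMulVec_residual M hK, ← add_assoc,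
        ← trace_add, ← Matrix.mul_add, completing_square hK, ← trace_add, ← trace_add,
        ← Matrix.mul_add, ← Matrix.mul_add]
      congr 2
      abel
    rw [niwKernel_of_posDef _ _ _ _ hV, niwKernel_of_posDef _ _ _ _ hV, ← h3,
      mul_add _ ((y - θ.A *ᵥ x) ⬝ᵥ _) (_ + _), Real.exp_add, h2, normalDensity, h1]
    simp only [one_div, mul_inv]
    ring
  · rw [niwKernel_of_not_posDef _ _ _ _ hV, niwKernel_of_not_posDef _ _ _ _ hV, mul_zero, mul_zero]

/-- The predictive density, in the coordinate in which it does not depend on `M`, `K`, `x`. -/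
def residualDensity (m : ℕ) (Q : Matrix (Fin d) (Fin d) ℝ) (n : ℝ) (w : Fin d → ℝ) : ℝ :=
  niwScale d m n / niwScale d m (n + 1) * ((2 * Real.pi) ^ ((d : ℝ) / 2))⁻¹ * Q.det ^ (n / 2) *
    (Q + vecMulVec w w).det ^ (-((n + 1) / 2))

variable {K : Matrix ι ι ℝ} {Q : Matrix (Fin d) (Fin d) ℝ} {n : ℝ}

theorem residualDensity_pos (m : ℕ) (hQ : Q.PosDef) (hn : (d : ℝ) - 1 < n) (w : Fin d → ℝ) :
    0 < residualDensity m Q n w := by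
  have h1 := niwScale_pos m hn
  have h2 := niwScale_pos m (show (d : ℝ) - 1 < n + 1 by linarith)
  have h3 := hQ.det_pos
  have h4 := (posDef_add_vecMulVec hQ w).det_pos
  unfold residualDensity
  positivity

/-- Bayes' rule without integrating: the second factor is a normalized density in `θ`, so the first
must be the predictive density. The powers of `|K|` and `|K'|` combine into the shrinkage factor. -/
theorem jointDensity_eq (M : Matrix (Fin d) ι ℝ) (hK : K.PosDef) (hQ : Q.PosDef)
    (hn : (d : ℝ) - 1 < n) (x : ι → ℝ) (y : Fin d → ℝ) (θ : Param d ι) :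
    jointDensity M K Q n x y θ = (shrinkage K x ^ ((d : ℝ) / 2) *
        residualDensity (Fintype.card ι) Q n (residual M K x y)) *
      priorDensity (updatedMean M K x y) (vecMulVec x x + K)
        (Q + vecMulVec (residual M K x y) (residual M K x y)) (n + 1) θ := by
  have hQ' := posDef_add_vecMulVec hQ (residual M K x y)
  have hK' := posDef_vecMulVec_add hK x
  have hk := hK.det_pos
  have hk' := hK'.det_pos
  have hq := hQ.det_pos
  have hq' := hQ'.det_pos
  have h2 := niwScale_pos (Fintype.card ι) (show (d : ℝ) - 1 < n + 1 by linarith)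
  rw [jointDensity, priorDensity_eq hQ, priorDensity_eq hQ', mul_left_comm,
    normalDensity_mul_niwKernel M hK]
  have hν : ((Fintype.card ι : ℝ) + d + 1 + n) / 2 + 1 / 2 =
    ((Fintype.card ι : ℝ) + d + 1 + (n + 1)) / 2 := by ring
  rw [hν, ← mul_assoc, ← mul_assoc]
  congr 1
  rw [niwConst, niwConst, residualDensity, shrinkage, Real.div_rpow hk.le hk'.le,
    Real.rpow_neg hq'.le]
  field_simp

theorem integrable_jointDensity (M : Matrix (Fin d) ι ℝ) (hK : K.PosDef) (hQ : Q.PosDef)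
    (hn : (d : ℝ) - 1 < n) (x : ι → ℝ) (y : Fin d → ℝ) :
    Integrable (jointDensity M K Q n x y) := by
  rw [funext (jointDensity_eq M hK hQ hn x y)]
  exact (integrable_priorDensity _ (posDef_vecMulVec_add hK x) (posDef_add_vecMulVec hQ _)
    (by linarith)).const_mul _

theorem predictiveDensity_eq (M : Matrix (Fin d) ι ℝ) (hK : K.PosDef) (hQ : Q.PosDef)
    (hn : (d : ℝ) - 1 < n) (x : ι → ℝ) (y : Fin d → ℝ) :
    predictiveDensity M K Q n x y = shrinkage K x ^ ((d : ℝ) / 2) *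
        residualDensity (Fintype.card ι) Q n (residual M K x y) := by
  rw [predictiveDensity, funext (jointDensity_eq M hK hQ hn x y), integral_const_mul,
    integral_priorDensity _ (posDef_vecMulVec_add hK x) (posDef_add_vecMulVec hQ _)
      (by linarith), mul_one]

theorem predictiveDensity_pos (M : Matrix (Fin d) ι ℝ) (hK : K.PosDef) (hQ : Q.PosDef)
    (hn : (d : ℝ) - 1 < n) (x : ι → ℝ) (y : Fin d → ℝ) :
    0 < predictiveDensity M K Q n x y := by
  rw [predictiveDensity_eq M hK hQ hn]
  exact mul_pos (Real.rpow_pos_of_pos (shrinkage_pos hK x) _) (residualDensity_pos _ hQ hn _)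

theorem posteriorDensity_eq (M : Matrix (Fin d) ι ℝ) (hK : K.PosDef) (hQ : Q.PosDef)
    (hn : (d : ℝ) - 1 < n) (x : ι → ℝ) (y : Fin d → ℝ) :
    posteriorDensity M K Q n x y = priorDensity (updatedMean M K x y) (vecMulVec x x + K)
        (Q + vecMulVec (residual M K x y) (residual M K x y)) (n + 1) := by
  ext θ
  rw [posteriorDensity, jointDensity_eq M hK hQ hn, ← predictiveDensity_eq M hK hQ hn,
    mul_div_cancel_left₀ _ (predictiveDensity_pos M hK hQ hn x y).ne']

theorem jointDensity_nonneg (M : Matrix (Fin d) ι ℝ) (hK : K.PosDef) (hQ : Q.PosDef)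
    (hn : (d : ℝ) - 1 < n) (x : ι → ℝ) (y : Fin d → ℝ) (θ : Param d ι) :
    0 ≤ jointDensity M K Q n x y θ := by
  rw [jointDensity_eq M hK hQ hn, ← predictiveDensity_eq M hK hQ hn]
  exact mul_nonneg (predictiveDensity_pos M hK hQ hn x y).le (priorDensity_nonneg _
    (posDef_vecMulVec_add hK x) (posDef_add_vecMulVec hQ _) (by linarith) θ)

/-! ### Measurability of the joint density, and its total mass -/

theorem measurable_normalDensity (x : ι → ℝ) :
    Measurable fun p : (Fin d → ℝ) × Param d ι =>
      normalDensity p.1 (p.2.A *ᵥ x) p.2.V := by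
  have hV : Continuous fun p : (Fin d → ℝ) × Param d ι => p.2.V :=
    continuous_paramV.comp continuous_snd
  have hA : Continuous fun p : (Fin d → ℝ) × Param d ι => p.2.A :=
    continuous_paramA.comp continuous_snd
  have h1 : Continuous fun p : (Fin d → ℝ) × Param d ι => ((2 * Real.pi) • p.2.V).det := by
    fun_prop
  have h2 : Continuous fun p : (Fin d → ℝ) × Param d ι => p.2.V.det := by fun_prop
  have h3 : Continuous fun p : (Fin d → ℝ) × Param d ι =>
      (p.1 - p.2.A *ᵥ x) ⬝ᵥ (p.2.V.adjugate *ᵥ (p.1 - p.2.A *ᵥ x)) := by fun_prop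
  have h4 : ∀ p : (Fin d → ℝ) × Param d ι,
      (p.1 - p.2.A *ᵥ x) ⬝ᵥ (p.2.V⁻¹ *ᵥ (p.1 - p.2.A *ᵥ x)) = p.2.V.det⁻¹ *
        ((p.1 - p.2.A *ᵥ x) ⬝ᵥ (p.2.V.adjugate *ᵥ (p.1 - p.2.A *ᵥ x))) := by
    intro p
    rw [inv_def, Ring.inverse_eq_inv', smul_mulVec, dotProduct_smul, smul_eq_mul]
  unfold normalDensity
  simp_rw [h4]
  exact ((h1.measurable.pow_const _).const_div _).mul
    ((h2.measurable.inv.mul h3.measurable).const_mul _).exp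

theorem measurable_jointDensity (M : Matrix (Fin d) ι ℝ) (K : Matrix ι ι ℝ) (hQ : Q.PosDef)
    (n : ℝ) (x : ι → ℝ) :
    Measurable fun p : (Fin d → ℝ) × Param d ι => jointDensity M K Q n x p.1 p.2 :=
  (measurable_normalDensity x).mul ((measurable_priorDensity M K hQ n).comp measurable_snd)

theorem measurable_predictiveDensity (M : Matrix (Fin d) ι ℝ) (K : Matrix ι ι ℝ) (hQ : Q.PosDef)
    (n : ℝ) (x : ι → ℝ) : Measurable (predictiveDensity M K Q n x) :=
  (measurable_jointDensity M K hQ n x).stronglyMeasurable.integral_prod_right'.measurable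

theorem lintegral_normalDensity {V : Matrix (Fin d) (Fin d) ℝ} (hV : V.PosDef) (μ : Fin d → ℝ) :
    ∫⁻ y, ENNReal.ofReal (normalDensity y μ V) = 1 := by
  have hv := hV.det_pos
  have hp : 0 < ((2 * Real.pi) • V).det ^ ((1 : ℝ) / 2) :=
    Real.rpow_pos_of_pos (hV.smul (by positivity : (0 : ℝ) < 2 * Real.pi)).det_pos _
  unfold normalDensity
  simp_rw [ENNReal.ofReal_mul (one_div_pos.mpr hp).le]
  rw [lintegral_const_mul' _ _ ENNReal.ofReal_ne_top, lintegral_gaussian hV.inv,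
    ← ENNReal.ofReal_mul (one_div_pos.mpr hp).le, ← ENNReal.ofReal_one]
  congr 1
  rw [one_div_mul_eq_div, div_eq_one_iff_eq hp.ne', det_smul, Fintype.card_fin,
    Real.mul_rpow (by positivity) hv.le, ← Real.rpow_natCast, ← Real.rpow_mul (by positivity),
    det_nonsing_inv, Ring.inverse_eq_inv', Real.inv_rpow hv.le, ← Real.rpow_neg hv.le, neg_neg]
  congr 2
  ring

theorem lintegral_jointDensity_left (M : Matrix (Fin d) ι ℝ) (hK : K.PosDef) (hQ : Q.PosDef)
    (hn : (d : ℝ) - 1 < n) (x : ι → ℝ) (θ : Param d ι) :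
    ∫⁻ y, ENNReal.ofReal (jointDensity M K Q n x y θ) =
      ENNReal.ofReal (priorDensity M K Q n θ) := by
  have hp := priorDensity_nonneg M hK hQ hn θ
  by_cases hV : θ.V.PosDef
  · simp_rw [jointDensity, mul_comm _ (priorDensity M K Q n θ), ENNReal.ofReal_mul hp]
    rw [lintegral_const_mul' _ _ ENNReal.ofReal_ne_top, lintegral_normalDensity hV, mul_one]
  -- When `V` is not positive definite the normal formula need not have mass one, but the prior
  -- vanishes there.
  · have h0 : priorDensity M K Q n θ = 0 := by
      rw [priorDensity_eq hQ, niwKernel_of_not_posDef _ _ _ _ hV, mul_zero]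
    simp [jointDensity, h0]

theorem lintegral_jointDensity_right (M : Matrix (Fin d) ι ℝ) (hK : K.PosDef) (hQ : Q.PosDef)
    (hn : (d : ℝ) - 1 < n) (x : ι → ℝ) (y : Fin d → ℝ) :
    ∫⁻ θ, ENNReal.ofReal (jointDensity M K Q n x y θ) =
      ENNReal.ofReal (predictiveDensity M K Q n x y) :=
  (ofReal_integral_eq_lintegral_ofReal (integrable_jointDensity M hK hQ hn x y)
    (ae_of_all _ (jointDensity_nonneg M hK hQ hn x y))).symm

theorem lintegral_predictiveDensity (M : Matrix (Fin d) ι ℝ) (hK : K.PosDef) (hQ : Q.PosDef)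
    (hn : (d : ℝ) - 1 < n) (x : ι → ℝ) :
    ∫⁻ y, ENNReal.ofReal (predictiveDensity M K Q n x y) = 1 := by
  simp_rw [← lintegral_jointDensity_right M hK hQ hn x]
  rw [lintegral_lintegral_swap
    (measurable_jointDensity M K hQ n x).ennreal_ofReal.aemeasurable]
  simp_rw [lintegral_jointDensity_left M hK hQ hn x]
  exact lintegral_priorDensity M hK hQ hn

theorem integrable_predictiveDensity (M : Matrix (Fin d) ι ℝ) (hK : K.PosDef) (hQ : Q.PosDef)
    (hn : (d : ℝ) - 1 < n) (x : ι → ℝ) : Integrable (predictiveDensity M K Q n x) := by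
  refine ⟨(measurable_predictiveDensity M K hQ n x).aestronglyMeasurable, ?_⟩
  rw [hasFiniteIntegral_iff_ofReal
    (ae_of_all _ fun y => (predictiveDensity_pos M hK hQ hn x y).le),
    lintegral_predictiveDensity M hK hQ hn]
  exact ENNReal.one_lt_top

theorem integral_predictiveDensity (M : Matrix (Fin d) ι ℝ) (hK : K.PosDef) (hQ : Q.PosDef)
    (hn : (d : ℝ) - 1 < n) (x : ι → ℝ) : ∫ y, predictiveDensity M K Q n x y = 1 := by
  rw [integral_eq_lintegral_of_nonneg_ae
    (ae_of_all _ fun y => (predictiveDensity_pos M hK hQ hn x y).le)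
    (measurable_predictiveDensity M K hQ n x).aestronglyMeasurable,
    lintegral_predictiveDensity M hK hQ hn, ENNReal.toReal_one]

end Bayes

/-! ### The expected posterior entropy -/

section Entropy

set_option linter.unusedSectionVars false

variable {d : ℕ} {ι : Type} [Fintype ι] [DecidableEq ι]
variable {K : Matrix ι ι ℝ} {Q : Matrix (Fin d) (Fin d) ℝ} {n : ℝ}

/-- Up to a constant this is a predictive density: take one regressor equal to zero, `M = 0`, `K =
1` and `n = 2r - 1`. The condition on `r` is then the one on the degrees of freedom. -/
theorem integrable_det_add_vecMulVec_rpow (hQ : Q.PosDef) {r : ℝ} (hr : (d : ℝ) / 2 < r) :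
    Integrable fun w : Fin d → ℝ => (Q + vecMulVec w w).det ^ (-r) := by
  have hn : (d : ℝ) - 1 < 2 * r - 1 := by linarith
  have hone : (1 : Matrix Unit Unit ℝ).PosDef := PosDef.one
  have h := integrable_predictiveDensity (0 : Matrix (Fin d) Unit ℝ) hone hQ hn 0
  have hs : shrinkage (1 : Matrix Unit Unit ℝ) 0 = 1 := by simp [shrinkage]
  have h1 := niwScale_pos (Fintype.card Unit) hn
  have h2 := niwScale_pos (Fintype.card Unit) (show (d : ℝ) - 1 < 2 * r - 1 + 1 by linarith)
  have h3 := hQ.det_pos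
  rw [funext (predictiveDensity_eq (0 : Matrix (Fin d) Unit ℝ) hone hQ hn 0)] at h
  simp only [residual, hs, Real.sqrt_one, mulVec_zero, sub_zero, one_smul, Real.one_rpow, one_mul,
    residualDensity] at h
  rw [integrable_const_mul_iff (IsUnit.mk0 _ (by positivity))] at h
  convert! h using 3
  ring

/-- Integrals over `y` in terms of the residual. -/
theorem integral_comp_residual (M : Matrix (Fin d) ι ℝ) (hK : K.PosDef) (x : ι → ℝ)
    (f : (Fin d → ℝ) → ℝ) :
    shrinkage K x ^ ((d : ℝ) / 2) * ∫ y, f (residual M K x y) = ∫ w, f w := by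
  have hs := shrinkage_pos hK x
  simp only [residual]
  rw [integral_sub_right_eq_self (fun y => f (Real.sqrt (shrinkage K x) • y)) (M *ᵥ x),
    Measure.integral_comp_smul, smul_eq_mul, ← mul_assoc, abs_inv, abs_pow,
    abs_of_nonneg (Real.sqrt_nonneg _), Module.finrank_fin_fun]
  have : Real.sqrt (shrinkage K x) ^ d = shrinkage K x ^ ((d : ℝ) / 2) := by
    rw [Real.sqrt_eq_rpow, ← Real.rpow_natCast, ← Real.rpow_mul hs.le]
    congr 1
    ring
  rw [this, mul_inv_cancel₀ (by positivity), one_mul]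

theorem integrable_comp_residual (M : Matrix (Fin d) ι ℝ) (hK : K.PosDef) (x : ι → ℝ)
    {f : (Fin d → ℝ) → ℝ} (hf : Integrable f) : Integrable fun y => f (residual M K x y) :=
  (hf.comp_smul (Real.sqrt_pos.mpr (shrinkage_pos hK x)).ne').comp_sub_right (M *ᵥ x)

theorem integrable_posteriorDensity_mul_log (M : Matrix (Fin d) ι ℝ) (hK : K.PosDef)
    (hQ : Q.PosDef) (hn : (d : ℝ) - 1 < n) (x : ι → ℝ) (y : Fin d → ℝ) :
    Integrable fun θ =>
      posteriorDensity M K Q n x y θ * Real.log (posteriorDensity M K Q n x y θ) := by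
  rw [posteriorDensity_eq M hK hQ hn]
  exact integrable_priorDensity_mul_log _ (posDef_vecMulVec_add hK x)
    (posDef_add_vecMulVec hQ _) (by linarith)

theorem jointDensity_mul_log_posteriorDensity (M : Matrix (Fin d) ι ℝ) (hK : K.PosDef)
    (hQ : Q.PosDef) (hn : (d : ℝ) - 1 < n) (x : ι → ℝ) (y : Fin d → ℝ) (θ : Param d ι) :
    jointDensity M K Q n x y θ * Real.log (posteriorDensity M K Q n x y θ) =
      predictiveDensity M K Q n x y *
        (posteriorDensity M K Q n x y θ * Real.log (posteriorDensity M K Q n x y θ)) := by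
  rw [← mul_assoc]
  congr 1
  rw [posteriorDensity, mul_div_cancel₀ _ (predictiveDensity_pos M hK hQ hn x y).ne']

/-- For fixed `y`, the inner integral of the absolute value is bounded by powers of `|Q + w wᵀ|`.
The predictive density decays like its power `-(n+1)/2`, which exceeds the integrability threshold
with room for a small perturbation. -/
theorem integrable_jointDensity_mul_log_posteriorDensity (M : Matrix (Fin d) ι ℝ) (hK : K.PosDef)
    (hQ : Q.PosDef) (hn : (d : ℝ) - 1 < n) (x : ι → ℝ) :
    Integrable (fun p : (Fin d → ℝ) × Param d ι => jointDensity M K Q n x p.1 p.2 *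
      Real.log (posteriorDensity M K Q n x p.1 p.2)) (volume.prod volume) := by
  have hj := measurable_jointDensity M K hQ n x
  have hr : Measurable fun p : (Fin d → ℝ) × Param d ι => predictiveDensity M K Q n x p.1 :=
    (measurable_predictiveDensity M K hQ n x).comp measurable_fst
  have hmeas : Measurable fun p : (Fin d → ℝ) × Param d ι => jointDensity M K Q n x p.1 p.2 *
      Real.log (posteriorDensity M K Q n x p.1 p.2) := hj.mul (hj.div hr).log
  rw [integrable_prod_iff hmeas.aestronglyMeasurable]
  simp only [jointDensity_mul_log_posteriorDensity M hK hQ hn x]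
  refine ⟨ae_of_all _ fun y =>
    (integrable_posteriorDensity_mul_log M hK hQ hn x y).const_mul _, ?_⟩
  have h0 : (0 : ℝ) ≤ d := by positivity
  have h1 : (0 : ℝ) ≤ Fintype.card ι := by positivity
  have hn1 : (d : ℝ) - 1 < n + 1 := by linarith
  have hN : 0 < (Fintype.card ι : ℝ) + d + 1 + (n + 1) := by linarith
  -- A single `δ` serves twice: for the moment bound with `n + 1` degrees of freedom, and for
  -- keeping both exponents `(n+1)/2 ± δN/2` above `d/2`.
  obtain ⟨δ, hδ, hδ1, hδn⟩ : ∃ δ : ℝ, 0 < δ ∧ δ < 1 ∧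
      δ * (Fintype.card ι + d + 1 + (n + 1)) < n + 1 - d := by
    refine ⟨(n + 1 - d) / (2 * (Fintype.card ι + d + 1 + (n + 1))),
      div_pos (by linarith) (by linarith), ?_, ?_⟩
    · rw [div_lt_one (by linarith)]
      linarith
    · rw [div_mul_eq_mul_div, div_lt_iff₀ (by linarith)]
      nlinarith
  set N : ℝ := (Fintype.card ι : ℝ) + d + 1 with hNdef
  set K' := vecMulVec x x + K with hK'
  have hδN : δ * N < n + 1 - d := by nlinarith
  have hδN0 : 0 ≤ δ * N := by positivity
  have i1 := integrable_comp_residual M hK x (integrable_det_add_vecMulVec_rpow hQ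
    (r := (n + 1) / 2 + δ * (N / 2)) (by linarith))
  have i2 := integrable_comp_residual M hK x (integrable_det_add_vecMulVec_rpow hQ
    (r := (n + 1) / 2 - δ * (N / 2)) (by linarith))
  set c : ℝ := shrinkage K x ^ ((d : ℝ) / 2) * (niwScale d (Fintype.card ι) n /
    niwScale d (Fintype.card ι) (n + 1) * ((2 * Real.pi) ^ ((d : ℝ) / 2))⁻¹ * Q.det ^ (n / 2))
    with hc
  refine Integrable.mono' (((i1.const_mul (niwPowConst d (Fintype.card ι) (n + 1) (1 + δ) *
      K'.det ^ (δ * (d / 2)))).add (i2.const_mul (niwPowConst d (Fintype.card ι) (n + 1) (1 - δ) *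
      K'.det ^ (-δ * (d / 2))))).const_mul (c * δ⁻¹)) ?_ (ae_of_all _ fun y => ?_)
  · simp only [← jointDensity_mul_log_posteriorDensity M hK hQ hn x]
    exact (hmeas.norm.stronglyMeasurable.integral_prod_right').aestronglyMeasurable
  · have hb := (integrable_and_integral_abs_priorDensity_mul_log_le (updatedMean M K x y)
      (posDef_vecMulVec_add hK x) (posDef_add_vecMulVec hQ (residual M K x y)) hn1 hδ hδ1
      (by linarith)).2
    rw [← posteriorDensity_eq M hK hQ hn, ← hK'] at hb
    have hp := predictiveDensity_pos M hK hQ hn x y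
    have hq := (posDef_add_vecMulVec hQ (residual M K x y)).det_pos
    rw [Real.norm_of_nonneg (integral_nonneg fun _ => norm_nonneg _)]
    simp only [Real.norm_eq_abs, abs_mul (predictiveDensity M K Q n x y), abs_of_pos hp]
    rw [integral_const_mul]
    refine (mul_le_mul_of_nonneg_left hb hp.le).trans_eq ?_
    rw [predictiveDensity_eq M hK hQ hn, residualDensity, Pi.add_apply,
      show -((n + 1) / 2 + δ * (N / 2)) = -((n + 1) / 2) + -δ * (N / 2) by ring,
      show -((n + 1) / 2 - δ * (N / 2)) = -((n + 1) / 2) + δ * (N / 2) by ring,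
      Real.rpow_add hq, Real.rpow_add hq, hc]
    ring

theorem predictiveDensity_mul_entropy (M : Matrix (Fin d) ι ℝ) (hK : K.PosDef)
    (hQ : Q.PosDef) (hn : (d : ℝ) - 1 < n) (x : ι → ℝ) (y : Fin d → ℝ) :
    predictiveDensity M K Q n x y * entropy (posteriorDensity M K Q n x y) =
      -∫ θ, jointDensity M K Q n x y θ * Real.log (posteriorDensity M K Q n x y θ) := by
  simp only [jointDensity_mul_log_posteriorDensity M hK hQ hn x]
  rw [integral_const_mul, entropy, mul_neg]

theorem integrable_predictiveDensity_mul_entropy (M : Matrix (Fin d) ι ℝ) (hK : K.PosDef)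
    (hQ : Q.PosDef) (hn : (d : ℝ) - 1 < n) (x : ι → ℝ) :
    Integrable fun y =>
      predictiveDensity M K Q n x y * entropy (posteriorDensity M K Q n x y) := by
  simp only [predictiveDensity_mul_entropy M hK hQ hn x]
  exact (integrable_jointDensity_mul_log_posteriorDensity M hK hQ hn x).integral_prod_left.neg

theorem expectedPosteriorEntropy_eq_neg_integral (M : Matrix (Fin d) ι ℝ) (hK : K.PosDef)
    (hQ : Q.PosDef) (hn : (d : ℝ) - 1 < n) (x : ι → ℝ) :
    expectedPosteriorEntropy M K Q n x = -∫ p : (Fin d → ℝ) × Param d ι,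
      jointDensity M K Q n x p.1 p.2 * Real.log (posteriorDensity M K Q n x p.1 p.2)
        ∂(volume.prod volume) := by
  rw [integral_prod _ (integrable_jointDensity_mul_log_posteriorDensity M hK hQ hn x),
    ← integral_neg, expectedPosteriorEntropy]
  simp only [predictiveDensity_mul_entropy M hK hQ hn x]

/-- The part of the expected posterior entropy that depends only on `Q`, `n` and the dimensions. -/
def baseEntropy (ι : Type) [Fintype ι] [DecidableEq ι] (Q : Matrix (Fin d) (Fin d) ℝ) (n : ℝ) : ℝ :=
  ∫ w, residualDensity (Fintype.card ι) Q n w *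
    entropy (priorDensity (0 : Matrix (Fin d) ι ℝ) 1 (Q + vecMulVec w w) (n + 1))

/-- The log determinant does not depend on `y` and averages against mass one. The remainder depends
on `y` through the residual only, and the power of the shrinkage is the Jacobian of that change of
variables. -/
theorem expectedPosteriorEntropy_eq (M : Matrix (Fin d) ι ℝ) (hK : K.PosDef)
    (hQ : Q.PosDef) (hn : (d : ℝ) - 1 < n) (x : ι → ℝ) :
    expectedPosteriorEntropy M K Q n x =
      -((d : ℝ) / 2) * Real.log (vecMulVec x x + K).det + baseEntropy ι Q n := by
  have hH : ∀ y, entropy (posteriorDensity M K Q n x y) =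
      -((d : ℝ) / 2) * Real.log (vecMulVec x x + K).det +
        entropy (priorDensity (0 : Matrix (Fin d) ι ℝ) 1
          (Q + vecMulVec (residual M K x y) (residual M K x y)) (n + 1)) := by
    intro y
    rw [posteriorDensity_eq M hK hQ hn, entropy_priorDensity _ (posDef_vecMulVec_add hK x)
      (posDef_add_vecMulVec hQ _) (by linarith)]
  have hi := integrable_predictiveDensity M hK hQ hn x
  have hie := integrable_predictiveDensity_mul_entropy M hK hQ hn x
  -- Subtracting the constant part uses only integrability already known; none is needed for the
  -- integrand defining `baseEntropy`.
  rw [← sub_eq_iff_eq_add']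
  calc _ = ∫ y, (predictiveDensity M K Q n x y * entropy (posteriorDensity M K Q n x y) -
        -((d : ℝ) / 2) * Real.log (vecMulVec x x + K).det * predictiveDensity M K Q n x y) := by
        rw [integral_sub hie (hi.const_mul _), integral_const_mul,
          integral_predictiveDensity M hK hQ hn, mul_one, expectedPosteriorEntropy]
    _ = ∫ y, shrinkage K x ^ ((d : ℝ) / 2) *
          (residualDensity (Fintype.card ι) Q n (residual M K x y) *
            entropy (priorDensity (0 : Matrix (Fin d) ι ℝ) 1
              (Q + vecMulVec (residual M K x y) (residual M K x y)) (n + 1))) := by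
        refine integral_congr_ae (ae_of_all _ fun y => ?_)
        simp only [hH, predictiveDensity_eq M hK hQ hn]
        ring
    _ = _ := by
        rw [integral_const_mul, integral_comp_residual M hK x (fun w =>
          residualDensity (Fintype.card ι) Q n w *
            entropy (priorDensity (0 : Matrix (Fin d) ι ℝ) 1 (Q + vecMulVec w w) (n + 1))),
          baseEntropy]

end Entropy

/-! ### Kullback-Leibler divergence of densities -/

/-- By `hfg`, `f = g · (f / g)` everywhere, so `f / g` is the Radon-Nikodym derivative. The total
masses are equal, so the divergence is the integral of the log-likelihood ratio with no correction
term. -/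
theorem klDiv_withDensity_ofReal {α : Type*} [MeasurableSpace α] {ρ : Measure α} [SigmaFinite ρ]
    {f g : α → ℝ} (hf : Measurable f) (hg : Measurable g) (hf0 : ∀ a, 0 ≤ f a) (hg0 : ∀ a, 0 ≤ g a)
    (hfg : ∀ a, g a = 0 → f a = 0)
    [IsProbabilityMeasure (ρ.withDensity fun a => ENNReal.ofReal (f a))]
    [IsProbabilityMeasure (ρ.withDensity fun a => ENNReal.ofReal (g a))]
    (hint : Integrable (fun a => f a * Real.log (f a / g a)) ρ) :
    InformationTheory.klDiv (ρ.withDensity fun a => ENNReal.ofReal (f a))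
        (ρ.withDensity fun a => ENNReal.ofReal (g a)) ≠ ⊤ ∧
    (InformationTheory.klDiv (ρ.withDensity fun a => ENNReal.ofReal (f a))
        (ρ.withDensity fun a => ENNReal.ofReal (g a))).toReal =
      ∫ a, f a * Real.log (f a / g a) ∂ρ := by
  set μ := ρ.withDensity fun a => ENNReal.ofReal (f a) with hμ
  set ν := ρ.withDensity fun a => ENNReal.ofReal (g a) with hν
  have hquot : Measurable fun a => ENNReal.ofReal (f a / g a) := (hf.div hg).ennreal_ofReal
  have hμν : μ = ν.withDensity fun a => ENNReal.ofReal (f a / g a) := by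
    rw [hν, ← withDensity_mul _ hg.ennreal_ofReal hquot, hμ]
    congr 1
    ext a
    rw [Pi.mul_apply, ← ENNReal.ofReal_mul (hg0 a)]
    by_cases h : g a = 0
    · simp [h, hfg a h]
    · rw [mul_div_cancel₀ _ h]
  have hac : μ ≪ ν := hμν ▸ withDensity_absolutelyContinuous _ _
  have hrn : μ.rnDeriv ν =ᵐ[μ] fun a => ENNReal.ofReal (f a / g a) := by
    refine hac.ae_eq ?_
    conv_lhs => rw [hμν]
    exact Measure.rnDeriv_withDensity ν hquot
  have hllr : llr μ ν =ᵐ[μ] fun a => Real.log (f a / g a) := by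
    filter_upwards [hrn] with a ha
    rw [llr, ha, ENNReal.toReal_ofReal (div_nonneg (hf0 a) (hg0 a))]
  have hint' : Integrable (llr μ ν) μ := by
    rw [integrable_congr hllr, hμ, integrable_withDensity_iff_integrable_smul'
      hf.ennreal_ofReal (ae_of_all _ fun _ => ENNReal.ofReal_lt_top)]
    simpa only [ENNReal.toReal_ofReal (hf0 _), smul_eq_mul] using hint
  refine ⟨InformationTheory.klDiv_ne_top hac hint', ?_⟩
  rw [InformationTheory.toReal_klDiv_of_measure_eq hac (by simp), integral_congr_ae hllr, hμ,
    integral_withDensity_eq_integral_toReal_smul hf.ennreal_ofReal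
      (ae_of_all _ fun _ => ENNReal.ofReal_lt_top)]
  simp only [ENNReal.toReal_ofReal (hf0 _), smul_eq_mul]

/-! ### The joint law of the parameters and the output -/

theorem map_withDensity_comp {α β : Type*} [MeasurableSpace α] [MeasurableSpace β] {μ : Measure α}
    {ν : Measure β} {S : α → β} (hS : MeasurePreserving S μ ν) {D : β → ENNReal}
    (hD : Measurable D) : (μ.withDensity (D ∘ S)).map S = ν.withDensity D := by
  ext s hs
  rw [Measure.map_apply hS.measurable hs, withDensity_apply _ (hS.measurable hs),
    withDensity_apply _ hs, ← hS.setLIntegral_comp_preimage hs hD]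
  rfl

theorem map_fst_withDensity_prod {α β : Type*} [MeasurableSpace α] [MeasurableSpace β]
    {μ : Measure α} {ν : Measure β} [SFinite μ] [SFinite ν] {D : α × β → ENNReal}
    (hD : Measurable D) :
    ((μ.prod ν).withDensity D).map Prod.fst = μ.withDensity fun a => ∫⁻ b, D (a, b) ∂ν := by
  ext s hs
  rw [Measure.map_apply measurable_fst hs, withDensity_apply _ (measurable_fst hs),
    withDensity_apply _ hs, ← Set.prod_univ, ← Measure.prod_restrict, Measure.restrict_univ,
    lintegral_prod _ hD.aemeasurable]

theorem map_snd_withDensity_prod {α β : Type*} [MeasurableSpace α] [MeasurableSpace β]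
    {μ : Measure α} {ν : Measure β} [SFinite μ] [SFinite ν] {D : α × β → ENNReal}
    (hD : Measurable D) :
    ((μ.prod ν).withDensity D).map Prod.snd = ν.withDensity fun b => ∫⁻ a, D (a, b) ∂μ := by
  ext s hs
  rw [Measure.map_apply measurable_snd hs, withDensity_apply _ (measurable_snd hs),
    withDensity_apply _ hs, ← Set.univ_prod, ← Measure.prod_restrict, Measure.restrict_univ,
    lintegral_prod_symm _ hD.aemeasurable]

section Info

set_option linter.unusedSectionVars false

variable {d : ℕ} {ι : Type} [Fintype ι] [DecidableEq ι]
variable {K : Matrix ι ι ℝ} {Q : Matrix (Fin d) (Fin d) ℝ} {n : ℝ}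

/-- For each `θ` the map translates the noise by `A x`; hence passing from `(θ, e)` to `(θ, y)`
introduces no Jacobian. -/
theorem measurePreserving_shear (x : ι → ℝ) :
    MeasurePreserving (fun ω : Param d ι × (Fin d → ℝ) => (ω.1, output x ω))
      (volume.prod volume) (volume.prod volume) := by
  have hA := continuous_paramA (d := d) (ι := ι)
  have hm : Measurable (Function.uncurry fun (θ : Param d ι) (e : Fin d → ℝ) =>
      θ.A *ᵥ x + e) := by
    refine Continuous.measurable ?_
    have : Continuous fun ω : Param d ι × (Fin d → ℝ) => ω.1.A := hA.comp continuous_fst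
    unfold Function.uncurry
    fun_prop
  exact (MeasurePreserving.id volume).skew_product hm
    (ae_of_all _ fun θ => map_add_left_eq_self volume (θ.A *ᵥ x))

theorem measurable_jointDensity_swap (M : Matrix (Fin d) ι ℝ) (K : Matrix ι ι ℝ) (hQ : Q.PosDef)
    (n : ℝ) (x : ι → ℝ) :
    Measurable fun p : Param d ι × (Fin d → ℝ) => jointDensity M K Q n x p.2 p.1 :=
  Measurable.comp (g := fun p : (Fin d → ℝ) × Param d ι => jointDensity M K Q n x p.1 p.2)
    (f := Prod.swap) (measurable_jointDensity M K hQ n x) measurable_swap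

theorem map_modelLaw (M : Matrix (Fin d) ι ℝ) (K : Matrix ι ι ℝ) (hQ : Q.PosDef)
    (n : ℝ) (x : ι → ℝ) :
    (modelLaw M K Q n).map (fun ω => (ω.1, output x ω)) = (volume.prod volume).withDensity
      fun p : Param d ι × (Fin d → ℝ) => ENNReal.ofReal (jointDensity M K Q n x p.2 p.1) := by
  rw [← map_withDensity_comp (measurePreserving_shear x)
    (measurable_jointDensity_swap M K hQ n x).ennreal_ofReal]
  congr 1
  refine congrArg (Measure.withDensity (volume.prod volume)) (funext fun ω => ?_)
  simp only [Function.comp_apply, jointDensity, output, normalDensity, add_sub_cancel_left,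
    sub_zero]
  rw [mul_comm]

theorem map_fst_modelLaw (M : Matrix (Fin d) ι ℝ) (hK : K.PosDef) (hQ : Q.PosDef)
    (hn : (d : ℝ) - 1 < n) : (modelLaw M K Q n).map Prod.fst =
      volume.withDensity fun θ => ENNReal.ofReal (priorDensity M K Q n θ) := by
  -- The law of `θ` does not involve the regressor, so the value `0` is an arbitrary choice.
  have h := congrArg (Measure.map Prod.fst) (map_modelLaw M K hQ n 0)
  rw [Measure.map_map measurable_fst (measurePreserving_shear 0).measurable,
    map_fst_withDensity_prod (measurable_jointDensity_swap M K hQ n 0).ennreal_ofReal] at h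
  simp only [lintegral_jointDensity_left M hK hQ hn 0] at h
  exact h

theorem map_output_modelLaw (M : Matrix (Fin d) ι ℝ) (hK : K.PosDef) (hQ : Q.PosDef)
    (hn : (d : ℝ) - 1 < n) (x : ι → ℝ) : (modelLaw M K Q n).map (output x) =
      volume.withDensity fun y => ENNReal.ofReal (predictiveDensity M K Q n x y) := by
  have h := congrArg (Measure.map Prod.snd) (map_modelLaw M K hQ n x)
  rw [Measure.map_map measurable_snd (measurePreserving_shear x).measurable,
    map_snd_withDensity_prod (measurable_jointDensity_swap M K hQ n x).ennreal_ofReal] at h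
  simp only [lintegral_jointDensity_right M hK hQ hn x] at h
  exact h

theorem isProbabilityMeasure_modelLaw (M : Matrix (Fin d) ι ℝ) (hK : K.PosDef) (hQ : Q.PosDef)
    (hn : (d : ℝ) - 1 < n) : IsProbabilityMeasure (modelLaw M K Q n) := by
  constructor
  have h := congrArg (fun μ => μ Set.univ) (map_fst_modelLaw M hK hQ hn)
  rw [Measure.map_apply measurable_fst MeasurableSet.univ, withDensity_apply _ MeasurableSet.univ,
    Measure.restrict_univ, lintegral_priorDensity M hK hQ hn] at h
  rwa [Set.preimage_univ] at h

/-! ### The information gain -/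

theorem integral_jointDensity_left (M : Matrix (Fin d) ι ℝ) (hK : K.PosDef) (hQ : Q.PosDef)
    (hn : (d : ℝ) - 1 < n) (x : ι → ℝ) (θ : Param d ι) :
    Integrable (fun y => jointDensity M K Q n x y θ) ∧
      ∫ y, jointDensity M K Q n x y θ = priorDensity M K Q n θ := by
  have h := lintegral_jointDensity_left M hK hQ hn x θ
  have hm : Measurable fun y => jointDensity M K Q n x y θ :=
    Measurable.comp (g := fun p : (Fin d → ℝ) × Param d ι => jointDensity M K Q n x p.1 p.2)
      (f := fun y => (y, θ)) (measurable_jointDensity M K hQ n x) measurable_prodMk_right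
  have h0 : ∀ y, 0 ≤ jointDensity M K Q n x y θ := fun y => jointDensity_nonneg M hK hQ hn x y θ
  constructor
  · refine ⟨hm.aestronglyMeasurable, ?_⟩
    rw [hasFiniteIntegral_iff_ofReal (ae_of_all _ h0), h]
    exact ENNReal.ofReal_lt_top
  · rw [integral_eq_lintegral_of_nonneg_ae (ae_of_all _ h0) hm.aestronglyMeasurable, h,
      ENNReal.toReal_ofReal (priorDensity_nonneg M hK hQ hn θ)]

theorem integrable_jointDensity_mul_log_priorDensity (M : Matrix (Fin d) ι ℝ) (hK : K.PosDef)
    (hQ : Q.PosDef) (hn : (d : ℝ) - 1 < n) (x : ι → ℝ) :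
    Integrable (fun p : Param d ι × (Fin d → ℝ) => jointDensity M K Q n x p.2 p.1 *
      Real.log (priorDensity M K Q n p.1)) (volume.prod volume) := by
  have hm : Measurable fun p : Param d ι × (Fin d → ℝ) => jointDensity M K Q n x p.2 p.1 *
      Real.log (priorDensity M K Q n p.1) := (measurable_jointDensity_swap M K hQ n x).mul
    ((measurable_priorDensity M K hQ n).comp measurable_fst).log
  rw [integrable_prod_iff hm.aestronglyMeasurable]
  refine ⟨ae_of_all _ fun θ => (integral_jointDensity_left M hK hQ hn x θ).1.mul_const
    (Real.log (priorDensity M K Q n θ)), ?_⟩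
  have h := (integrable_priorDensity_mul_log M hK hQ hn).norm
  refine h.congr (ae_of_all _ fun θ => ?_)
  simp only [norm_mul, Real.norm_of_nonneg (jointDensity_nonneg M hK hQ hn x _ _),
    Real.norm_of_nonneg (priorDensity_nonneg M hK hQ hn _)]
  rw [integral_mul_const, (integral_jointDensity_left M hK hQ hn x θ).2]

theorem integral_jointDensity_mul_log_priorDensity (M : Matrix (Fin d) ι ℝ) (hK : K.PosDef)
    (hQ : Q.PosDef) (hn : (d : ℝ) - 1 < n) (x : ι → ℝ) :
    ∫ p : Param d ι × (Fin d → ℝ), jointDensity M K Q n x p.2 p.1 *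
      Real.log (priorDensity M K Q n p.1) ∂(volume.prod volume) =
        -entropy (priorDensity M K Q n) := by
  rw [integral_prod _ (integrable_jointDensity_mul_log_priorDensity M hK hQ hn x), entropy, neg_neg]
  refine integral_congr_ae (ae_of_all _ fun θ => ?_)
  simp only
  rw [integral_mul_const, (integral_jointDensity_left M hK hQ hn x θ).2]

/-- Wherever the joint density is nonzero, the log ratio is log posterior minus log prior. Both
terms are integrable against the joint density, so the integral splits into the two entropies. -/
theorem infoGain_ne_top_and_toReal_eq (M : Matrix (Fin d) ι ℝ) (hK : K.PosDef)
    (hQ : Q.PosDef) (hn : (d : ℝ) - 1 < n) (x : ι → ℝ) :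
    infoGain M K Q n x ≠ ⊤ ∧ (infoGain M K Q n x).toReal =
      entropy (priorDensity M K Q n) - expectedPosteriorEntropy M K Q n x := by
  have hj := measurable_jointDensity_swap M K hQ n x
  have hp := measurable_priorDensity M K hQ n
  have hr := measurable_predictiveDensity M K hQ n x
  have hj0 : ∀ p : Param d ι × (Fin d → ℝ), 0 ≤ jointDensity M K Q n x p.2 p.1 :=
    fun p => jointDensity_nonneg M hK hQ hn x p.2 p.1
  have hp0 := priorDensity_nonneg M hK hQ hn
  have hr0 := predictiveDensity_pos M hK hQ hn x
  have hprob := isProbabilityMeasure_modelLaw M hK hQ hn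
  have hS := measurePreserving_shear (d := d) x
  have hjoint := map_modelLaw M K hQ n x
  have hprod : ((modelLaw M K Q n).map Prod.fst).prod ((modelLaw M K Q n).map (output x)) =
      (volume.prod volume).withDensity fun p : Param d ι × (Fin d → ℝ) =>
        ENNReal.ofReal (priorDensity M K Q n p.1 * predictiveDensity M K Q n x p.2) := by
    rw [map_fst_modelLaw M hK hQ hn, map_output_modelLaw M hK hQ hn,
      prod_withDensity hp.ennreal_ofReal hr.ennreal_ofReal]
    simp only [ENNReal.ofReal_mul (hp0 _)]
  have hout : Measurable (output x : Param d ι × (Fin d → ℝ) → Fin d → ℝ) :=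
    measurable_snd.comp hS.measurable
  have hP1 : IsProbabilityMeasure ((modelLaw M K Q n).map fun ω => (ω.1, output x ω)) :=
    Measure.isProbabilityMeasure_map hS.measurable.aemeasurable
  have hP2 : IsProbabilityMeasure ((modelLaw M K Q n).map Prod.fst) :=
    Measure.isProbabilityMeasure_map measurable_fst.aemeasurable
  have hP3 : IsProbabilityMeasure ((modelLaw M K Q n).map (output x)) :=
    Measure.isProbabilityMeasure_map hout.aemeasurable
  have hP4 : IsProbabilityMeasure
      (((modelLaw M K Q n).map Prod.fst).prod ((modelLaw M K Q n).map (output x))) := inferInstance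
  rw [hjoint] at hP1
  rw [hprod] at hP4
  have hzero : ∀ p : Param d ι × (Fin d → ℝ), priorDensity M K Q n p.1 = 0 →
      jointDensity M K Q n x p.2 p.1 = 0 := fun p h => by rw [jointDensity, h, mul_zero]
  have hpt : ∀ p : Param d ι × (Fin d → ℝ), jointDensity M K Q n x p.2 p.1 *
      Real.log (jointDensity M K Q n x p.2 p.1 /
        (priorDensity M K Q n p.1 * predictiveDensity M K Q n x p.2)) =
      jointDensity M K Q n x p.2 p.1 * Real.log (posteriorDensity M K Q n x p.2 p.1) -
        jointDensity M K Q n x p.2 p.1 * Real.log (priorDensity M K Q n p.1) := by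
    intro p
    by_cases h : jointDensity M K Q n x p.2 p.1 = 0
    · simp [h]
    · have h1 : priorDensity M K Q n p.1 ≠ 0 := fun h' => h (hzero p h')
      rw [mul_comm (priorDensity M K Q n p.1), ← div_div,
        Real.log_div (div_ne_zero h (hr0 _).ne') h1, mul_sub]
      rfl
  have hI1 : Integrable (fun p : Param d ι × (Fin d → ℝ) => jointDensity M K Q n x p.2 p.1 *
      Real.log (posteriorDensity M K Q n x p.2 p.1)) (volume.prod volume) :=
    (integrable_jointDensity_mul_log_posteriorDensity M hK hQ hn x).swap
  have hI2 := integrable_jointDensity_mul_log_priorDensity M hK hQ hn x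
  have hI : Integrable (fun p : Param d ι × (Fin d → ℝ) => jointDensity M K Q n x p.2 p.1 *
      Real.log (jointDensity M K Q n x p.2 p.1 /
        (priorDensity M K Q n p.1 * predictiveDensity M K Q n x p.2))) (volume.prod volume) := by
    simp only [hpt]
    exact hI1.sub hI2
  have hkl := klDiv_withDensity_ofReal (ρ := volume.prod volume)
    (f := fun p : Param d ι × (Fin d → ℝ) => jointDensity M K Q n x p.2 p.1)
    (g := fun p => priorDensity M K Q n p.1 * predictiveDensity M K Q n x p.2) hj
    ((hp.comp measurable_fst).mul (hr.comp measurable_snd)) hj0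
    (fun p => mul_nonneg (hp0 p.1) (hr0 p.2).le)
    (fun p h => hzero p ((mul_eq_zero.mp h).resolve_right (hr0 p.2).ne')) hI
  rw [infoGain, mutualInfo, hjoint, hprod]
  refine ⟨hkl.1, hkl.2.trans ?_⟩
  simp only [hpt]
  have hsw := integral_prod_swap (ν := (volume : Measure (Param d ι)))
    (μ := (volume : Measure (Fin d → ℝ)))
    (fun p : (Fin d → ℝ) × Param d ι => jointDensity M K Q n x p.1 p.2 *
      Real.log (posteriorDensity M K Q n x p.1 p.2))
  simp only [Prod.fst_swap, Prod.snd_swap] at hsw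
  rw [integral_sub hI1 hI2, integral_jointDensity_mul_log_priorDensity M hK hQ hn x,
    expectedPosteriorEntropy_eq_neg_integral M hK hQ hn x, ← hsw]
  ring

/-! ### Optimal controls -/

theorem log_det_le_log_det_iff (hK : K.PosDef) (x x' : ι → ℝ) :
    Real.log (vecMulVec x x + K).det ≤ Real.log (vecMulVec x' x' + K).det ↔
      x ⬝ᵥ (K⁻¹ *ᵥ x) ≤ x' ⬝ᵥ (K⁻¹ *ᵥ x') := by
  rw [Real.log_le_log_iff (posDef_vecMulVec_add hK x).det_pos (posDef_vecMulVec_add hK x').det_pos,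
    add_comm _ K, add_comm _ K, det_add_vecMulVec hK.det_pos.ne',
    det_add_vecMulVec hK.det_pos.ne', mul_le_mul_iff_right₀ hK.det_pos, add_le_add_iff_left]

theorem expectedPosteriorEntropy_le_iff (hd : 1 ≤ d) (M : Matrix (Fin d) ι ℝ) (hK : K.PosDef)
    (hQ : Q.PosDef) (hn : (d : ℝ) - 1 < n) (x x' : ι → ℝ) :
    expectedPosteriorEntropy M K Q n x' ≤ expectedPosteriorEntropy M K Q n x ↔
      x ⬝ᵥ (K⁻¹ *ᵥ x) ≤ x' ⬝ᵥ (K⁻¹ *ᵥ x') := by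
  have hd' : 0 < (d : ℝ) / 2 := by
    have : (1 : ℝ) ≤ d := by exact_mod_cast hd
    linarith
  rw [expectedPosteriorEntropy_eq M hK hQ hn, expectedPosteriorEntropy_eq M hK hQ hn,
    add_le_add_iff_right, neg_mul, neg_mul, neg_le_neg_iff, mul_le_mul_iff_right₀ hd',
    log_det_le_log_det_iff hK]

/-- The prior entropy is the same for all regressors, and finiteness lets the comparison be made
between real numbers. -/
theorem infoGain_le_iff (hd : 1 ≤ d) (M : Matrix (Fin d) ι ℝ) (hK : K.PosDef)
    (hQ : Q.PosDef) (hn : (d : ℝ) - 1 < n) (x x' : ι → ℝ) :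
    infoGain M K Q n x ≤ infoGain M K Q n x' ↔ x ⬝ᵥ (K⁻¹ *ᵥ x) ≤ x' ⬝ᵥ (K⁻¹ *ᵥ x') := by
  have h := infoGain_ne_top_and_toReal_eq M hK hQ hn x
  have h' := infoGain_ne_top_and_toReal_eq M hK hQ hn x'
  rw [← ENNReal.toReal_le_toReal h.1 h'.1, h.2, h'.2, sub_le_sub_iff_left,
    expectedPosteriorEntropy_le_iff hd M hK hQ hn]

end Info

/-! ### Continuity of the regressor in the control -/

theorem continuous_regressor {d c I J : ℕ} (r : Fin (I + 1) → Fin d → ℝ)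
    (uPast : Fin J → Fin c → ℝ) :
    Continuous (regressor r uPast : (Fin c → ℝ) → RegIdx d c I J → ℝ) := by
  refine continuous_pi fun i => ?_
  rcases i with p | ⟨j, k⟩
  · exact continuous_const
  · cases j using Fin.lastCases with
    | last =>
      simp only [regressor, Sum.elim_inr, Fin.snoc_last]
      exact continuous_apply k
    | cast j =>
      simp only [regressor, Sum.elim_inr, Fin.snoc_castSucc]
      exact continuous_const

end Infomax

end

/-! ### The main theorem -/

open Infomax in
theorem mainTheorem1 (d c I J : ℕ) (hd : 1 ≤ d)
    (Q : Matrix (Fin d) (Fin d) ℝ) (hQ : Q.PosDef) (n : ℝ) (hn : (d : ℝ) - 1 < n) :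
    -- the constant depends only on the dimensions, `Q` and `n`
    ∃ g : ℝ, ∀ (M : Matrix (Fin d) (RegIdx d c I J) ℝ)
      (K : Matrix (RegIdx d c I J) (RegIdx d c I J) ℝ), K.PosDef →
      -- the model is a genuine probability model whose prior entropy is finite
      IsProbabilityMeasure (modelLaw M K Q n) ∧
      Integrable (fun θ => priorDensity M K Q n θ * Real.log (priorDensity M K Q n θ)) ∧
      -- conditional entropy and mutual information for every regressor `x`
      (∀ x : RegIdx d c I J → ℝ,
        (∀ y, Integrable (jointDensity M K Q n x y) ∧ 0 < predictiveDensity M K Q n x y ∧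
          Integrable (fun θ =>
            posteriorDensity M K Q n x y θ * Real.log (posteriorDensity M K Q n x y θ))) ∧
        Integrable (fun y =>
          predictiveDensity M K Q n x y * entropy (posteriorDensity M K Q n x y)) ∧
        expectedPosteriorEntropy M K Q n x =
          -((d : ℝ) / 2) * Real.log (vecMulVec x x + K).det + g ∧
        infoGain M K Q n x ≠ ⊤ ∧
        (infoGain M K Q n x).toReal =
          entropy (priorDensity M K Q n) - expectedPosteriorEntropy M K Q n x) ∧
      -- the greedy control over a bounded domain `U`
      ∀ (r : Fin (I + 1) → Fin d → ℝ) (uPast : Fin J → Fin c → ℝ) (U : Set (Fin c → ℝ)),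
        Bornology.IsBounded U →
        argmaxOn (fun u => infoGain M K Q n (regressor r uPast u)) U =
          argmaxOn (fun u => regressor r uPast u ⬝ᵥ (K⁻¹ *ᵥ regressor r uPast u)) U ∧
        argminOn (fun u => expectedPosteriorEntropy M K Q n (regressor r uPast u)) U =
          argmaxOn (fun u => regressor r uPast u ⬝ᵥ (K⁻¹ *ᵥ regressor r uPast u)) U ∧
        argminOn (fun u => -((d : ℝ) / 2) * Real.log
            (vecMulVec (regressor r uPast u) (regressor r uPast u) + K).det) U =
          argmaxOn (fun u => regressor r uPast u ⬝ᵥ (K⁻¹ *ᵥ regressor r uPast u)) U ∧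
        BddAbove ((fun u => regressor r uPast u ⬝ᵥ (K⁻¹ *ᵥ regressor r uPast u)) '' U) ∧
        (U.Nonempty → IsClosed U →
          (argmaxOn (fun u => infoGain M K Q n (regressor r uPast u)) U).Nonempty) := by
  refine ⟨baseEntropy (RegIdx d c I J) Q n, fun M K hK => ⟨isProbabilityMeasure_modelLaw M hK hQ hn,
    integrable_priorDensity_mul_log M hK hQ hn, fun x => ⟨fun y =>
      ⟨integrable_jointDensity M hK hQ hn x y, predictiveDensity_pos M hK hQ hn x y,
        integrable_posteriorDensity_mul_log M hK hQ hn x y⟩,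
      integrable_predictiveDensity_mul_entropy M hK hQ hn x,
      expectedPosteriorEntropy_eq M hK hQ hn x, infoGain_ne_top_and_toReal_eq M hK hQ hn x⟩,
    fun r uPast U hU => ?_⟩⟩
  have hcont : Continuous fun u => regressor r uPast u ⬝ᵥ (K⁻¹ *ᵥ regressor r uPast u) := by
    have := continuous_regressor (I := I) r uPast
    fun_prop
  have hd' : 0 < (d : ℝ) / 2 := by
    have : (1 : ℝ) ≤ d := by exact_mod_cast hd
    linarith
  have hinfo : argmaxOn (fun u => infoGain M K Q n (regressor r uPast u)) U =
      argmaxOn (fun u => regressor r uPast u ⬝ᵥ (K⁻¹ *ᵥ regressor r uPast u)) U := by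
    ext u
    simp only [argmaxOn, Set.mem_ofPred_eq, isMaxOn_iff, infoGain_le_iff hd M hK hQ hn]
  refine ⟨hinfo, ?_, ?_, ?_, fun hne hcl => ?_⟩
  · ext u
    simp only [argmaxOn, argminOn, Set.mem_ofPred_eq, isMaxOn_iff, isMinOn_iff,
      expectedPosteriorEntropy_le_iff hd M hK hQ hn]
  · ext u
    simp only [argmaxOn, argminOn, Set.mem_ofPred_eq, isMaxOn_iff, isMinOn_iff, neg_mul,
      neg_le_neg_iff, mul_le_mul_iff_right₀ hd', log_det_le_log_det_iff hK]
  -- `U` need not be closed here, so compactness is taken from its closure.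
  · exact ((hU.isCompact_closure.image hcont).bddAbove).mono (Set.image_mono subset_closure)
  · rw [hinfo]
    obtain ⟨u, hu, hmax⟩ := (Metric.isCompact_of_isClosed_isBounded hcl hU).exists_isMaxOn hne
      hcont.continuousOn
    exact ⟨u, hu, hmax⟩
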